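/- Let $I\subset\mathbb R$ be a finite set of charges and $\mu$ a probability measure on $I$. A charged scatterer configuration is a countable set $\omega=\{(x_n,Q_{j_n})\}_{n\in\mathbb N}$, where $\{x_n\}\subset\mathbb R^3$ is infinite and locally finite and each point $x_n$ carries one charge $Q_{j_n}\in I$. Let $\Omega\otimes I$ be the space of these configurations, with the $\sigma$-algebra generated by the numbers of scatterers of a given charge in bounded open sets. Let $\nu\otimes\mu$ be the law on it under which $\{x_n\}$ is a Poisson process of intensity one and the charges are independent with law $\mu$: for pairwise disjoint bounded Borel sets $U_i$, the numbers of scatterers of charge $Q$ in $U_i$ are independent Poisson variables with means $\mu(Q)|U_i|$. If $I=\{1\}$ we write $\Omega$ and $\nu$. Let $\Phi(x)=\frac1{|x|}$ on $\mathbb R^3\setminus\{0\}$, and let $U\subset\mathbb R^3$ be a bounded open set with $0\in U$ and $\partial U\in C^1$. For $R>0$ put $$F^{(R)}_U(x)\,\omega=-\sum_{x_n\in RU}Q_{j_n}\nabla\Phi(x-x_n),\qquad F^{(R),0}_U(x)\,\omega=-\Big[\sum_{x_n\in RU}\nabla\Phi(x-x_n)-\int_{RU}\nabla\Phi(x-y)\,dy\Big],$$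 the second one for $I=\{1\}$. Call a jointly measurable field $F_U(x)\,\omega$ a limit of $F^{(R)}_U$ (resp. of $F^{(R),0}_U$) if, for every $x\in\mathbb R^3$, $F^{(R)}_U(x)\to F_U(x)$ (resp. $F^{(R),0}_U(x)\to F_U(x)$) in probability, hence also in law, as $R\to\infty$. Such a field, if it exists, is unique up to modification. **(i)** Suppose that either $\sum_j Q_j\,\mu(Q_j)=0$, or $\int_U\nabla\big(\frac1{|y|}\big)dy=0$. Then the limit field $F_U$ of $F^{(R)}_U$ exists, and for every such $F_U$ and almost every $\omega=\{(x_n,Q_{j_n})\}_{n}\in\Omega\otimes I$ the function $\psi(x):=F_U(x)\,\omega$ is locally integrable and satisfies, in the sense of distributions on $\mathbb R^3$, $$\operatorname{div}\psi=4\pi\sum_n Q_{j_n}\,\delta(\cdot-x_n),\qquad \operatorname{curl}\psi=0 .$$ **(ii)** For $I=\{1\}$ the limit field $F_U$ of $F^{(R),0}_U$ exists, and for every such $F_U$ and almost every $\omega=\{x_n\}_n\in\Omega$ the function $\psi(x):=F_U(x)\,\omega$ is locally integrable and satisfies, in the sense of distributions on $\mathbb R^3$, $$\operatorname{div}\psi=4\pi\Big(\sum_n\delta(\cdot-x_n)-1\Big),\qquad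 \operatorname{curl}\psi=0 .$$ -/

import Mathlib

open Filter Topology MeasureTheory ProbabilityTheory
open scoped Pointwise

noncomputable section

namespace Holtsmark

/-- Euclidean three-dimensional space. -/
abbrev R3 : Type := EuclideanSpace ℝ (Fin 3)

/-- The space `Ω ⊗ I` of charged scatterer configurations: countable collections
`{(xₙ, Qₙ)}` of infinitely many distinct points `xₙ ∈ ℝ³`, finitely many of them in each compact
set, each carrying one charge `Qₙ` from the finite set `I ⊆ ℝ`. -/
@[ext]
structure ChargedConfig (I : Finset ℝ) where
  /-- the set of pairs (position, charge) -/
  carrier : Set (R3 × I)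
  /-- each scatterer position carries exactly one charge -/
  injOn_fst : Set.InjOn Prod.fst carrier
  infinite : carrier.Infinite
  locallyFinite : ∀ K : Set R3, IsCompact K → {p ∈ carrier | p.1 ∈ K}.Finite

/-- The number of scatterers of charge `q` in the region `U`. -/
def ChargedConfig.count {I : Finset ℝ} (ω : ChargedConfig I) (U : Set R3) (q : I) : ℕ :=
  {x : R3 | x ∈ U ∧ (x, q) ∈ ω.carrier}.ncard

/-- The σ-algebra generated by the events "exactly `m` scatterers of charge `q` lie in `U`",
with `U` bounded and open. -/
instance (I : Finset ℝ) : MeasurableSpace (ChargedConfig I) :=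
  MeasurableSpace.generateFrom
    {S | ∃ (U : Set R3) (q : I) (m : ℕ),
      IsOpen U ∧ Bornology.IsBounded U ∧ S = {ω : ChargedConfig I | ω.count U q = m}}

/-- `P` is the scatterer distribution `ν ⊗ μ`: the points form a Poisson process of intensity one
in `ℝ³` and the charges are independent with law `μ`. That is, for pairwise disjoint
bounded Borel sets `Uᵢ`, the numbers of scatterers of charge `q` in `Uᵢ` are independent
Poisson variables with parameters `μ(q) |Uᵢ|`. -/
def IsPoissonLaw {I : Finset ℝ} (μ : PMF I) (P : Measure (ChargedConfig I)) : Prop :=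
  ∀ (k : ℕ) (U : Fin k → Set R3),
    (∀ i, MeasurableSet (U i)) → (∀ i, Bornology.IsBounded (U i)) →
    (∀ i j, i ≠ j → Disjoint (U i) (U j)) →
    ∀ n : Fin k → I → ℕ,
      P {ω | ∀ i q, ω.count (U i) q = n i q} =
        ∏ i, ∏ q, poissonMeasure (μ q * volume (U i)).toNNReal {n i q}

/-- The mean charge `∑ⱼ Qⱼ μ(Qⱼ)`. -/
def meanCharge {I : Finset ℝ} (μ : PMF I) : ℝ :=
  ∑ q : I, (q : ℝ) * (μ q).toReal

/-- The Coulomb potential `Φ(x) = 1 / |x|`. -/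
def coulomb (x : R3) : ℝ := 1 / ‖x‖

/-- The boundary of `U` is of class `C¹`: near each boundary point, `U` is the
sublevel set `{g < 0}` of a `C¹` function with non-vanishing differential. -/
def HasC1Boundary (U : Set R3) : Prop :=
  ∀ p ∈ frontier U, ∃ g : R3 → ℝ,
    ContDiffAt ℝ 1 g p ∧ fderiv ℝ g p ≠ 0 ∧ ∀ᶠ x in 𝓝 p, (x ∈ U ↔ g x < 0)

/-- The field of the scatterers in `R U`:
`F_U^{(R)}(x) ω = - ∑_{xₙ ∈ R U} Qₙ ∇Φ(x - xₙ)` (a finite sum when `U` is bounded). -/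
def cloudField {I : Finset ℝ} (Φ : R3 → ℝ) (U : Set R3) (R : ℝ) (x : R3)
    (ω : ChargedConfig I) : R3 :=
  -∑ᶠ p ∈ {p ∈ ω.carrier | p.1 ∈ R • U}, (p.2 : ℝ) • gradient Φ (x - p.1)

/-- The field of the scatterers in `R U` with the uniform background subtracted:
`F_U^{(R),0}(x) ω = - [∑_{xₙ ∈ R U} ∇Φ(x - xₙ) - ∫_{R U} ∇Φ(x - y) dy]`;
all charges are equal to one. -/
def cloudFieldBackground (Φ : R3 → ℝ) (U : Set R3) (R : ℝ) (x : R3)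
    (ω : ChargedConfig {(1 : ℝ)}) : R3 :=
  -(∑ᶠ p ∈ {p ∈ ω.carrier | p.1 ∈ R • U}, gradient Φ (x - p.1)
    - ∫ y in R • U, gradient Φ (x - y))

/-- `F` is (a jointly measurable version of) the random force field `lim_{R → ∞} F^{(R)}`.
The convergence holds in law for every `x`, and the limit is realised on the same configuration
space as the approximating fields: `F^{(R)}(x) → F(x)` in probability for every `x`.
(The second convergence implies the first one, and it determines `F(x)` almost surely,
whereas the law alone would not relate `F(x) ω` to the configuration `ω`.) -/
structure IsLimitField {I : Finset ℝ} (P : Measure (ChargedConfig I)) [IsProbabilityMeasure P]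
    (FR : ℝ → R3 → ChargedConfig I → R3) (F : R3 → ChargedConfig I → R3) : Prop where
  measurable : Measurable (Function.uncurry F)
  tendsto_law : ∀ x, TendstoInDistribution (fun R : ℝ => FR R x) atTop (F x) (fun _ => P) P
  tendsto_prob : ∀ x, TendstoInMeasure P (fun R : ℝ => FR R x) atTop (F x)

/-- Test functions: `φ ∈ C_c^∞(ℝ³)`. -/
def IsTest (φ : R3 → ℝ) : Prop := ContDiff ℝ (⊤ : ℕ∞) φ ∧ HasCompactSupport φ

/-- `div ψ = T` in the sense of distributions. -/
def WeakDivEq (ψ : R3 → R3) (T : (R3 → ℝ) → ℝ) : Prop :=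
  ∀ φ : R3 → ℝ, IsTest φ → -∫ x, inner ℝ (ψ x) (gradient φ x) = T φ

/-- `curl ψ = 0` in the sense of distributions: `∂ᵢ ψⱼ - ∂ⱼ ψᵢ = 0` weakly for all `i, j`. -/
def WeakCurlZero (ψ : R3 → R3) : Prop :=
  ∀ φ : R3 → ℝ, IsTest φ → ∀ i j : Fin 3,
    ∫ x, (ψ x j * gradient φ x i - ψ x i * gradient φ x j) = 0

/-- The distribution `∑ₙ Qₙ δ(· - xₙ)`; the sum is finite on test functions. -/
def chargeDist {I : Finset ℝ} (ω : ChargedConfig I) (φ : R3 → ℝ) : ℝ :=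
  ∑ᶠ p ∈ ω.carrier, (p.2 : ℝ) * φ p.1

/-- The distribution `∑ₙ δ(· - xₙ)`; the sum is finite on test functions. -/
def pointDist {I : Finset ℝ} (ω : ChargedConfig I) (φ : R3 → ℝ) : ℝ :=
  ∑ᶠ p ∈ ω.carrier, φ p.1

end Holtsmark

end

/-! Write K = -∇Φ. The cloud field splits as a centered field, the sum of K(x - xₙ) minus its mean,
plus the mean charge times the deterministic field of the uniform density on `R • U`
(`cloudField_eq`); with the background subtracted, only the centered part is left
(`cloudFieldBackground_eq`).

The centered part always converges. For a Poisson process the variance of a linear statistic ∑ g(xₙ)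
is the integral of g² against the intensity. On a region between radii a and b the kernel is O(a⁻²),
so the fluctuation is O(b^(3/2) / a²) (`IsPoissonLaw.lintegral_enorm_centeredField_le`). Over dyadic
annuli this is O(2^(-n/2)), which is summable. Hence the dyadic fields converge in L¹(P) at each x
and, by Fubini, for almost every ω in L¹ of each ball. Since `R • U` lies between two balls of
comparable radii, its centered field has the same limit
(`IsPoissonLaw.tendsto_lintegral_centeredField_sub`).

The background part equals R b(x / R), where b is the field of the uniform density on U. If the
Coulomb integral of U vanishes, then b(0) = 0 and this converges to the derivative of b at 0 applied
to x (`exists_linear_tendsto_fieldOf_restrict_smul`). In the neutral case the coefficient is zero.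

The equations hold for K, hence by Fubini for the field of any finite measure
(`integral_inner_fieldOf`, `integral_curl_fieldOf`), and they survive L¹ convergence on balls. The
centered limit has divergence 4π times the charges minus the mean charge; the linear background
gives the mean charge back. Any other limit field agrees with the constructed one for almost every
x, for almost every ω, and the distributions see no more than that. -/

noncomputable section

namespace Holtsmark

open scoped ENNReal

/-! ### The Coulomb kernel and its local integrability. -/

section

/-- The Coulomb field `z / |z|³` of a unit charge at the origin. -/
def coulombField (z : R3) : R3 := (‖z‖ ^ 3)⁻¹ • z

/-- Taking ε = 0 gives the gradient of the Coulomb potential off the origin; positive ε gives the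
smooth regularizations behind the curl identity. -/
lemma hasGradientAt_inv_sqrt_norm_sq_add {ε : ℝ} {z : R3} (h : 0 < ‖z‖ ^ 2 + ε) :
    HasGradientAt (fun z : R3 => (√(‖z‖ ^ 2 + ε))⁻¹) (-((√(‖z‖ ^ 2 + ε) ^ 3)⁻¹ • z)) z := by
  rw [hasGradientAt_iff_hasFDerivAt]
  have h1 : HasFDerivAt (fun z : R3 => ‖z‖ ^ 2 + ε) (2 • (innerSL ℝ z)) z :=
    (hasStrictFDerivAt_norm_sq z).hasFDerivAt.add_const ε
  have hs : √(‖z‖ ^ 2 + ε) ≠ 0 := (Real.sqrt_pos.2 h).ne'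
  have h2 : HasDerivAt (fun s : ℝ => (√s)⁻¹)
      (-(1 / (2 * √(‖z‖ ^ 2 + ε))) / (√(‖z‖ ^ 2 + ε)) ^ 2) (‖z‖ ^ 2 + ε) :=
    (Real.hasDerivAt_sqrt h.ne').inv hs
  have h3 := h2.comp_hasFDerivAt z h1
  convert! h3 using 1
  ext v
  simp only [InnerProductSpace.toDual_apply_apply, inner_neg_left, inner_smul_left,
    _root_.smul_apply, innerSL_apply_apply, smul_eq_mul, nsmul_eq_mul]
  simp
  field_simp

lemma gradient_coulomb (z : R3) : gradient coulomb z = -coulombField z := by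
  by_cases hz : z = 0
  · subst hz
    -- The potential, set to 0 at the origin, is even, so its `fderiv` there equals its own
    -- negative; differentiability need not be decided.
    have h : fderiv ℝ coulomb (0 : R3) = 0 := by
      have h1 : (fun x => coulomb (-x)) = coulomb := by ext x; simp [coulomb]
      have h2 := fderiv_comp_smul (𝕜 := ℝ) (f := coulomb) (x := (0 : R3)) (-1)
      simp only [neg_smul, one_smul, neg_zero, h1] at h2
      ext v
      have h4 := congrArg (fun L => L v) h2
      exact self_eq_neg.1 h4
    simp [gradient, h, coulombField]
  · have h : (0 : ℝ) < ‖z‖ ^ 2 + 0 := by positivity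
    have h1 := (hasGradientAt_inv_sqrt_norm_sq_add h).gradient
    have h2 : (fun z : R3 => (√(‖z‖ ^ 2 + 0))⁻¹) = coulomb := by
      ext x; simp [coulomb]
    rw [h2] at h1
    rw [h1, coulombField]
    simp

lemma norm_coulombField (z : R3) : ‖coulombField z‖ = (‖z‖ ^ 2)⁻¹ := by
  rw [coulombField, norm_smul, norm_inv, norm_pow, norm_norm]
  by_cases hz : ‖z‖ = 0
  · simp [hz]
  · field_simp

@[fun_prop]
lemma measurable_coulombField : Measurable coulombField := by
  unfold coulombField; fun_prop

lemma coulombField_neg (z : R3) : coulombField (-z) = -coulombField z := by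
  simp [coulombField]

lemma coulombField_smul {c : ℝ} (hc : 0 < c) (z : R3) :
    coulombField (c • z) = (c ^ 2)⁻¹ • coulombField z := by
  rw [coulombField, coulombField, norm_smul, Real.norm_of_nonneg hc.le, smul_smul, smul_smul]
  congr 1
  have := hc.ne'
  by_cases hz : ‖z‖ = 0
  · simp [hz]
  · field_simp

/-- In polar coordinates the volume factor r² cancels the singularity r⁻². -/
lemma integrableOn_coulombField_ball (r : ℝ) :
    IntegrableOn coulombField (Metric.ball 0 r) := by
  have h : IntegrableOn (fun x : R3 => (fun y : ℝ => (y ^ 2)⁻¹) ‖x‖) (Metric.ball (0 : R3) r) := by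
    refine (integrableOn_fun_norm_addHaar volume (f := fun y : ℝ => (y ^ 2)⁻¹)).2 ?_
    have h1 : IntegrableOn (fun _ : ℝ => (1 : ℝ)) (Set.Ioo 0 r) := by
      simp [integrableOn_const_iff]
    refine h1.congr_fun (fun y hy => ?_) measurableSet_Ioo
    have : y ≠ 0 := hy.1.ne'
    simp [this]
  exact (integrable_norm_iff measurable_coulombField.aestronglyMeasurable).1
    (h.congr (.of_forall fun x => (norm_coulombField x).symm))

lemma locallyIntegrable_coulombField : LocallyIntegrable coulombField := by
  intro x
  refine ⟨Metric.ball 0 (‖x‖ + 1), Metric.isOpen_ball.mem_nhds (by simp), ?_⟩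
  exact integrableOn_coulombField_ball _

/-- The norm of K is at most 1 outside the unit ball, and inside it translation invariance removes
y. Uniformity in y is what permits Fubini against an arbitrary finite measure. -/
lemma exists_lintegral_coulombField_sub_le (ρ : ℝ) :
    ∃ C : ENNReal, C ≠ ⊤ ∧ ∀ y : R3,
      ∫⁻ x in Metric.ball (0 : R3) ρ, ‖coulombField (x - y)‖ₑ ≤ C := by
  refine ⟨(∫⁻ z in Metric.ball (0 : R3) 1, ‖coulombField z‖ₑ) + volume (Metric.ball (0 : R3) ρ),
    ENNReal.add_ne_top.2 ⟨(integrableOn_coulombField_ball 1).2.ne, measure_ball_lt_top.ne⟩,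
    fun y => ?_⟩
  have key : ∀ z : R3, ‖coulombField z‖ₑ ≤
      (Metric.ball (0 : R3) 1).indicator (fun z => ‖coulombField z‖ₑ) z + 1 := by
    intro z
    by_cases hz : z ∈ Metric.ball (0 : R3) 1
    · simp [Set.indicator_of_mem hz]
    · rw [Set.indicator_of_notMem hz, zero_add, ← ofReal_norm, norm_coulombField]
      have h1 : 1 ≤ ‖z‖ := by simpa using hz
      rw [← ENNReal.ofReal_one]
      exact ENNReal.ofReal_le_ofReal (inv_le_one_of_one_le₀ (one_le_pow₀ h1))
  calc ∫⁻ x in Metric.ball (0 : R3) ρ, ‖coulombField (x - y)‖ₑ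
      ≤ ∫⁻ x in Metric.ball (0 : R3) ρ,
        ((Metric.ball (0 : R3) 1).indicator (fun z => ‖coulombField z‖ₑ) (x - y) + 1) :=
        lintegral_mono fun x => key _
    _ = (∫⁻ x in Metric.ball (0 : R3) ρ,
        (Metric.ball (0 : R3) 1).indicator (fun z => ‖coulombField z‖ₑ) (x - y))
          + volume (Metric.ball (0 : R3) ρ) := by
        rw [lintegral_add_right _ measurable_const]; simp
    _ ≤ _ := by
        refine add_le_add_left ?_ _
        calc _ ≤ ∫⁻ x, (Metric.ball (0 : R3) 1).indicator (fun z => ‖coulombField z‖ₑ) (x - y) :=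
              setLIntegral_le_lintegral _ _
          _ = _ := by
              rw [lintegral_sub_right_eq_self
                (fun z => (Metric.ball (0 : R3) 1).indicator (fun z => ‖coulombField z‖ₑ) z) y,
                lintegral_indicator Metric.isOpen_ball.measurableSet]

end

/-! ### Test functions and the divergence of the Coulomb field. -/

section

lemma IsTest.gradient_inner {φ : R3 → ℝ} (x v : R3) :
    inner ℝ v (gradient φ x) = fderiv ℝ φ x v := by
  rw [real_inner_comm, gradient, InnerProductSpace.toDual_symm_apply]

lemma IsTest.differentiable {φ : R3 → ℝ} (h : IsTest φ) : Differentiable ℝ φ :=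
  h.1.differentiable (by simp)

lemma gradient_apply_eq (φ : R3 → ℝ) (x : R3) (i : Fin 3) :
    gradient φ x i = fderiv ℝ φ x (EuclideanSpace.single i 1) := by
  rw [← IsTest.gradient_inner, EuclideanSpace.inner_single_left]; simp

lemma IsTest.continuous_gradient {φ : R3 → ℝ} (h : IsTest φ) : Continuous (gradient φ) :=
  (InnerProductSpace.toDual ℝ R3).symm.continuous.comp (h.1.continuous_fderiv (by simp))

lemma IsTest.hasCompactSupport_gradient {φ : R3 → ℝ} (h : IsTest φ) :
    HasCompactSupport (gradient φ) :=
  (h.2.fderiv (𝕜 := ℝ)).comp_left (g := (InnerProductSpace.toDual ℝ R3).symm) (map_zero _)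

lemma IsTest.exists_support_subset {φ : R3 → ℝ} (h : IsTest φ) :
    ∃ ρ : ℕ, (∀ x, x ∉ Metric.ball (0 : R3) ρ → φ x = 0 ∧ gradient φ x = 0) := by
  obtain ⟨r, hr⟩ := (h.2.isBounded.union h.hasCompactSupport_gradient.isBounded).subset_ball 0
  obtain ⟨ρ, hρ⟩ := exists_nat_ge r
  refine ⟨ρ, fun x hx => ⟨?_, ?_⟩⟩ <;> by_contra hne
  · exact hx (Metric.ball_subset_ball hρ (hr (Or.inl (subset_tsupport _ hne))))
  · exact hx (Metric.ball_subset_ball hρ (hr (Or.inr (subset_tsupport _ hne))))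

lemma IsTest.comp_add_right {φ : R3 → ℝ} (h : IsTest φ) (p : R3) :
    IsTest (fun x => φ (x + p)) :=
  ⟨h.1.comp (contDiff_id.add contDiff_const), h.2.comp_homeomorph (Homeomorph.addRight p)⟩

lemma gradient_comp_add_right (φ : R3 → ℝ) (p x : R3) :
    gradient (fun x => φ (x + p)) x = gradient φ (x + p) := by
  rw [gradient, gradient, fderiv_comp_add_right]

lemma IsTest.integrable_coulombField_mul {φ : R3 → ℝ} (h : IsTest φ) :
    Integrable (fun z => ‖coulombField z‖ * ‖gradient φ z‖) := by
  have := (locallyIntegrable_coulombField.integrable_smul_left_of_hasCompactSupport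
    h.continuous_gradient.norm h.hasCompactSupport_gradient.norm).norm
  simpa only [norm_smul, norm_norm, mul_comm] using this

lemma integral_eq_integral_sphere_Ioi {G : R3 → ℝ} (hG : Integrable G) :
    ∫ z, G z = ∫ θ : Metric.sphere (0 : R3) 1,
      (∫ r in Set.Ioi (0 : ℝ), r ^ 2 * G (r • (θ : R3))) ∂(volume : Measure R3).toSphere := by
  set e := homeomorphUnitSphereProd R3
  have hmp := (volume : Measure R3).measurePreserving_homeomorphUnitSphereProd
  have hdim : Module.finrank ℝ R3 - 1 = 2 := by simp
  rw [hdim] at hmp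
  have hcomp : ∀ x : ({0}ᶜ : Set R3),
      (fun p : Metric.sphere (0 : R3) 1 × Set.Ioi (0 : ℝ) => G ((p.2 : ℝ) • (p.1 : R3))) (e x)
        = G x := by
    intro x
    have hx : ‖(x : R3)‖ ≠ 0 := norm_ne_zero_iff.2 x.2
    simp [e, smul_smul, hx]
  have hint : Integrable
      (fun p : Metric.sphere (0 : R3) 1 × Set.Ioi (0 : ℝ) => G ((p.2 : ℝ) • (p.1 : R3)))
      ((volume : Measure R3).toSphere.prod (Measure.volumeIoiPow 2)) := by
    rw [← hmp.integrable_comp_emb e.measurableEmbedding]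
    have h1 : Integrable (fun x : ({0}ᶜ : Set R3) => G x) ((volume : Measure R3).comap (↑)) := by
      have := (integrableOn_iff_comap_subtypeVal (measurableSet_singleton (0 : R3)).compl).1
        (hG.integrableOn (s := ({0}ᶜ : Set R3)))
      exact this
    exact h1.congr (.of_forall fun x => (hcomp x).symm)
  calc ∫ z, G z = ∫ x : ({0}ᶜ : Set R3), G x ∂((volume : Measure R3).comap (↑)) := by
        rw [integral_subtype_comap (measurableSet_singleton (0 : R3)).compl G,
          restrict_compl_singleton]
    _ = ∫ p, G ((p.2 : ℝ) • (p.1 : R3))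
          ∂((volume : Measure R3).toSphere.prod (Measure.volumeIoiPow 2)) := by
        rw [← hmp.integral_comp e.measurableEmbedding]
        exact integral_congr_ae (.of_forall fun x => (hcomp x).symm)
    _ = _ := by
        rw [integral_prod _ hint]
        refine integral_congr_ae (.of_forall fun θ => ?_)
        simp only [Measure.volumeIoiPow, ENNReal.ofReal]
        rw [integral_withDensity_eq_integral_smul,
          integral_subtype_comap measurableSet_Ioi
            fun a : ℝ => Real.toNNReal (a ^ 2) • G (a • (θ : R3))]
        · refine setIntegral_congr_fun measurableSet_Ioi fun x hx => ?_
          simp [NNReal.smul_def, sq_nonneg]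
        · exact (measurable_subtype_coe.pow_const _).real_toNNReal

/-- Along each ray r² ⟨K, ∇φ⟩ is the derivative of r ↦ φ(rθ), so every direction θ contributes
-φ(0), and the unit sphere has area 3 · 4π/3 = 4π. -/
lemma integral_inner_coulombField_gradient {φ : R3 → ℝ} (h : IsTest φ) :
    ∫ z, inner ℝ (coulombField z) (gradient φ z) = -(4 * Real.pi * φ 0) := by
  have hint : Integrable (fun z => inner ℝ (coulombField z) (gradient φ z)) := by
    refine h.integrable_coulombField_mul.mono'
      ((measurable_coulombField.inner h.continuous_gradient.measurable).aestronglyMeasurable) ?_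
    exact .of_forall fun z => norm_inner_le_norm _ _
  rw [integral_eq_integral_sphere_Ioi hint]
  have key : ∀ θ : Metric.sphere (0 : R3) 1,
      ∫ r in Set.Ioi (0 : ℝ), r ^ 2 * inner ℝ (coulombField (r • (θ : R3)))
        (gradient φ (r • (θ : R3))) = -φ 0 := by
    intro θ
    have hθ : ‖(θ : R3)‖ = 1 := by simp
    set f : ℝ → ℝ := fun r => φ (r • (θ : R3))
    have hf : ContDiff ℝ 1 f := (h.1.of_le (by simp)).comp (contDiff_id.smul contDiff_const)
    have hθ0 : (θ : R3) ≠ 0 := by rw [← norm_ne_zero_iff, hθ]; simp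
    have hfc : HasCompactSupport f :=
      h.2.comp_isClosedEmbedding (isClosedEmbedding_smul_left (𝕜 := ℝ) hθ0)
    have h1 := hfc.integral_Ioi_deriv_eq hf 0
    rw [show f 0 = φ 0 by simp [f]] at h1
    rw [← h1]
    refine setIntegral_congr_fun measurableSet_Ioi fun r hr => ?_
    have hr : 0 < r := hr
    have hd : deriv f r = fderiv ℝ φ (r • (θ : R3)) θ := by
      have h2 : HasDerivAt (fun r : ℝ => r • (θ : R3)) (θ : R3) r := by
        simpa using (hasDerivAt_id r).smul_const (θ : R3)
      exact ((h.differentiable _).hasFDerivAt.comp_hasDerivAt r h2).deriv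
    simp only [coulombField]
    rw [hd, ← IsTest.gradient_inner, smul_smul, inner_smul_left, norm_smul, hθ,
      Real.norm_of_nonneg hr.le]
    simp
    field_simp
  simp_rw [key]
  rw [integral_const, Measure.toSphere_real_apply_univ, measureReal_def,
    EuclideanSpace.volume_ball_fin_three]
  simp
  left
  rw [ENNReal.toReal_ofReal (by positivity)]
  ring

lemma integral_inner_coulombField_sub {φ : R3 → ℝ} (h : IsTest φ) (p : R3) :
    ∫ x, inner ℝ (coulombField (x - p)) (gradient φ x) = -(4 * Real.pi * φ p) := by
  rw [← integral_add_right_eq_self _ p]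
  simpa [gradient_comp_add_right] using integral_inner_coulombField_gradient (h.comp_add_right p)

end

/-! ### The curl of the Coulomb field. -/

section

/-- Integration by parts moves the derivative from f to φ, whose second derivative is symmetric; f
itself needs only one derivative. -/
lemma integral_fderiv_mul_fderiv_comm {f φ : R3 → ℝ} (hf : ContDiff ℝ 1 f) (h : IsTest φ)
    (v w : R3) :
    ∫ x, fderiv ℝ f x v * fderiv ℝ φ x w = ∫ x, fderiv ℝ f x w * fderiv ℝ φ x v := by
  have hφ' : ContDiff ℝ (⊤ : ℕ∞) (fderiv ℝ φ) := h.1.fderiv_right (by simp)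
  have hd : ∀ v, ContDiff ℝ (⊤ : ℕ∞) (fun x => fderiv ℝ φ x v) := fun v =>
    hφ'.clm_apply contDiff_const
  have hs : ∀ v, HasCompactSupport (fun x => fderiv ℝ φ x v) := fun v =>
    h.2.fderiv_apply (𝕜 := ℝ) v
  have hf' : ∀ v, Continuous (fun x => fderiv ℝ f x v) := fun v =>
    (hf.continuous_fderiv (by simp)).clm_apply continuous_const
  have key : ∀ v w, ∫ x, fderiv ℝ f x v * fderiv ℝ φ x w =
      -∫ x, f x * fderiv ℝ (fderiv ℝ φ) x v w := by
    intro v w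
    have h2 : ∀ x, fderiv ℝ (fun x => fderiv ℝ φ x w) x v = fderiv ℝ (fderiv ℝ φ) x v w := by
      intro x
      rw [fderiv_clm_apply ((hφ'.differentiable (by simp)) x) (differentiableAt_const w)]
      simp
    have h3 := integral_mul_fderiv_eq_neg_fderiv_mul_of_integrable (μ := volume) (f := f)
      (g := fun x => fderiv ℝ φ x w) (v := v)
      (((hf' v).mul (hd w).continuous).integrable_of_hasCompactSupport (hs w).mul_left)
      ((hf.continuous.mul (((hd w).continuous_fderiv (by simp)).clm_apply
        continuous_const)).integrable_of_hasCompactSupport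
          ((hs w).fderiv_apply (𝕜 := ℝ) v).mul_left)
      ((hf.continuous.mul (hd w).continuous).integrable_of_hasCompactSupport (hs w).mul_left)
      (fun x _ => hf.differentiable (by simp) x)
      (fun x _ => (hd w).differentiable (by simp) x)
    simp only [h2] at h3
    rw [h3, neg_neg]
  rw [key, key]
  congr 1
  refine integral_congr_ae (.of_forall fun x => ?_)
  have : IsSymmSndFDerivAt ℝ φ x := h.1.contDiffAt.isSymmSndFDerivAt
    (by simpa using WithTop.coe_le_coe.2 (le_top : (2 : ℕ∞) ≤ ⊤))
  simp only [this.eq v w]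

/-- K is the pointwise limit of the fields `K n` = -∇(‖z‖² + 1/(n+1))^(-1/2). These are gradients of
C¹ functions, hence curl-free, and are dominated by K in norm. -/
lemma integral_coulombField_curl {φ : R3 → ℝ} (h : IsTest φ) (i j : Fin 3) :
    ∫ z, (coulombField z j * gradient φ z i - coulombField z i * gradient φ z j) = 0 := by
  set K : ℕ → R3 → R3 := fun n z => (√(‖z‖ ^ 2 + 1 / ((n : ℝ) + 1)) ^ 3)⁻¹ • z
  set Φ : ℕ → R3 → ℝ := fun n z => (√(‖z‖ ^ 2 + 1 / ((n : ℝ) + 1)))⁻¹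
  have hpos : ∀ (n : ℕ) (z : R3), 0 < ‖z‖ ^ 2 + 1 / ((n : ℝ) + 1) := fun n z => by positivity
  have hΦ : ∀ n, ContDiff ℝ 1 (Φ n) := fun n =>
    (((contDiff_norm_sq ℝ).add contDiff_const).sqrt (fun z => (hpos n z).ne')).inv
      (fun z => (Real.sqrt_pos.2 (hpos n z)).ne')
  have hK : ∀ n z (k : Fin 3), K n z k = -fderiv ℝ (Φ n) z (EuclideanSpace.single k 1) := by
    intro n z k
    rw [← gradient_apply_eq, (hasGradientAt_inv_sqrt_norm_sq_add (hpos n z)).gradient]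
    simp [K]
  have hKc : ∀ n, Continuous (K n) := fun n =>
    (((continuous_norm.pow 2).add continuous_const).sqrt.pow 3).inv₀
      (fun z => pow_ne_zero _ (Real.sqrt_pos.2 (hpos n z)).ne') |>.smul continuous_id
  have hcoord : ∀ k : Fin 3, Continuous fun z : R3 => z k := fun k => by fun_prop
  have hnorm : ∀ n z, ‖K n z‖ ≤ ‖coulombField z‖ := by
    intro n z
    by_cases hz : z = 0
    · simp [K, hz]
    · have hz' : 0 < ‖z‖ := norm_pos_iff.2 hz
      simp only [K, coulombField, norm_smul, norm_inv, norm_pow, norm_norm]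
      gcongr
      rw [Real.norm_of_nonneg (Real.sqrt_nonneg _)]
      exact Real.le_sqrt_of_sq_le (by simp; positivity)
  have hint : ∀ n (k l : Fin 3), Integrable fun z => K n z k * gradient φ z l := by
    intro n k l
    refine Continuous.integrable_of_hasCompactSupport
      (((hcoord k).comp (hKc n)).mul ((hcoord l).comp h.continuous_gradient)) ?_
    exact (h.hasCompactSupport_gradient.comp_left (g := fun z : R3 => z l) (by simp)).mul_left
  have h0 : ∀ n, ∫ z, (K n z j * gradient φ z i - K n z i * gradient φ z j) = 0 := by
    intro n
    rw [integral_sub (hint n j i) (hint n i j)]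
    simp only [hK, gradient_apply_eq, neg_mul, integral_neg]
    rw [integral_fderiv_mul_fderiv_comm (hΦ n) h]
    ring
  have hlim := tendsto_integral_of_dominated_convergence (μ := volume)
    (F := fun n z => K n z j * gradient φ z i - K n z i * gradient φ z j)
    (f := fun z => coulombField z j * gradient φ z i - coulombField z i * gradient φ z j)
    (fun z => 2 * (‖coulombField z‖ * ‖gradient φ z‖))
    (fun n => ((hint n j i).sub (hint n i j)).aestronglyMeasurable)
    (h.integrable_coulombField_mul.const_mul 2)
    (fun n => .of_forall fun z => by
      have hb : ∀ k l : Fin 3, ‖K n z k * gradient φ z l‖ ≤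
          ‖coulombField z‖ * ‖gradient φ z‖ := fun k l => by
        rw [norm_mul]
        exact mul_le_mul ((PiLp.norm_apply_le _ _).trans (hnorm n z)) (PiLp.norm_apply_le _ _)
          (norm_nonneg _) (norm_nonneg _)
      refine (norm_sub_le _ _).trans ?_
      linarith [hb j i, hb i j])
    (.of_forall fun z => by
      have hz : ∀ k : Fin 3, Tendsto (fun n => K n z k) atTop (𝓝 (coulombField z k)) := by
        intro k
        by_cases hz : z = 0
        · simp [K, hz, coulombField]
        · have hz' : 0 < ‖z‖ := norm_pos_iff.2 hz
          have h1 : Tendsto (fun n : ℕ => ‖z‖ ^ 2 + 1 / ((n : ℝ) + 1)) atTop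
              (𝓝 (‖z‖ ^ 2 + 0)) := tendsto_const_nhds.add tendsto_one_div_add_atTop_nhds_zero_nat
          have h2 := (((Real.continuous_sqrt.tendsto _).comp h1).pow 3).inv₀
            (by simp [hz'.ne'])
          have h3 := h2.mul_const (z k)
          simpa [K, coulombField] using h3
      exact ((hz j).mul_const _).sub ((hz i).mul_const _))
  simp only [h0] at hlim
  exact tendsto_nhds_unique hlim tendsto_const_nhds

lemma integral_coulombField_sub_curl {φ : R3 → ℝ} (h : IsTest φ) (p : R3) (i j : Fin 3) :
    ∫ x, (coulombField (x - p) j * gradient φ x i - coulombField (x - p) i * gradient φ x j)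
      = 0 := by
  rw [← integral_add_right_eq_self _ p]
  simpa [gradient_comp_add_right] using integral_coulombField_curl (h.comp_add_right p) i j

end

/-! ### Fields of finite measures, with divergence and curl tested alike through linear forms. -/

section

/-- The Coulomb field of a charge distribution `η`. -/
def fieldOf (η : Measure R3) (x : R3) : R3 := ∫ y, coulombField (x - y) ∂η

/-- A continuous compactly supported field of linear forms, to be paired with vector fields. -/
structure IsTestForm (T : R3 → R3 →L[ℝ] ℝ) : Prop where
  continuous : Continuous T
  hasCompactSupport : HasCompactSupport T

lemma IsTestForm.exists_bound {T : R3 → R3 →L[ℝ] ℝ} (hT : IsTestForm T) :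
    (∃ M, ∀ x, ‖T x‖ ≤ M) ∧ ∃ ρ : ℕ, 0 < ρ ∧ ∀ x, x ∉ Metric.ball (0 : R3) ρ → T x = 0 := by
  refine ⟨hT.hasCompactSupport.exists_bound_of_continuous hT.continuous, ?_⟩
  obtain ⟨r, hr⟩ := hT.hasCompactSupport.isBounded.subset_ball 0
  obtain ⟨ρ, hρ⟩ := exists_nat_gt (max r 0)
  refine ⟨ρ, by exact_mod_cast (le_max_right _ _).trans_lt hρ, fun x hx => ?_⟩
  by_contra hne
  exact hx (Metric.ball_subset_ball ((le_max_left _ _).trans hρ.le) (hr (subset_tsupport _ hne)))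

lemma IsTestForm.measurable_apply {T : R3 → R3 →L[ℝ] ℝ} (hT : IsTestForm T) {ψ : R3 → R3}
    (hψ : Measurable ψ) : Measurable fun x => T x (ψ x) :=
  (isBoundedBilinearMap_apply (𝕜 := ℝ) (E := R3) (F := ℝ)).continuous.measurable.comp
    (hT.continuous.measurable.prodMk hψ)

lemma IsTestForm.integral_apply_eq_setIntegral {T : R3 → R3 →L[ℝ] ℝ} {ρ : ℝ}
    (hρ : ∀ x, x ∉ Metric.ball (0 : R3) ρ → T x = 0) (ψ : R3 → R3) :
    ∫ x, T x (ψ x) = ∫ x in Metric.ball 0 ρ, T x (ψ x) := by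
  refine (setIntegral_eq_integral_of_forall_compl_eq_zero fun x hx => ?_).symm
  rw [hρ x hx]; rfl

lemma IsTestForm.integrableOn_apply {T : R3 → R3 →L[ℝ] ℝ} (hT : IsTestForm T) {ψ : R3 → R3}
    {s : Set R3} (hψ : IntegrableOn ψ s) : IntegrableOn (fun x => T x (ψ x)) s := by
  obtain ⟨⟨M, hM⟩, -⟩ := hT.exists_bound
  refine (hψ.norm.const_mul M).mono'
    ((isBoundedBilinearMap_apply (𝕜 := ℝ) (E := R3) (F := ℝ)).continuous.comp_aestronglyMeasurable
      (hT.continuous.aestronglyMeasurable.prodMk hψ.aestronglyMeasurable))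
    (.of_forall fun x => ?_)
  exact ((T x).le_opNorm _).trans (mul_le_mul_of_nonneg_right (hM _) (norm_nonneg _))

lemma IsTestForm.integrable_apply {T : R3 → R3 →L[ℝ] ℝ} (hT : IsTestForm T) {ψ : R3 → R3}
    (hψ : ∀ ρ : ℕ, IntegrableOn ψ (Metric.ball 0 ρ)) : Integrable (fun x => T x (ψ x)) := by
  obtain ⟨-, ρ, -, hρ⟩ := hT.exists_bound
  refine (integrableOn_iff_integrable_of_support_subset fun x hx => ?_).1
    (hT.integrableOn_apply (hψ ρ))
  by_contra hx'
  exact hx (by simp [hρ x hx'])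

/-- The form `v ↦ ⟨v, ∇φ(x)⟩`. -/
def divForm (φ : R3 → ℝ) (x : R3) : R3 →L[ℝ] ℝ := InnerProductSpace.toDual ℝ R3 (gradient φ x)

lemma divForm_apply (φ : R3 → ℝ) (x v : R3) : divForm φ x v = inner ℝ v (gradient φ x) := by
  rw [divForm, InnerProductSpace.toDual_apply_apply, real_inner_comm]

lemma IsTest.isTestForm_divForm {φ : R3 → ℝ} (h : IsTest φ) : IsTestForm (divForm φ) :=
  ⟨(InnerProductSpace.toDual ℝ R3).continuous.comp h.continuous_gradient,
    h.hasCompactSupport_gradient.comp_left (g := InnerProductSpace.toDual ℝ R3) (map_zero _)⟩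

/-- The form `v ↦ vⱼ ∂ᵢφ(x) - vᵢ ∂ⱼφ(x)`. -/
def curlForm (φ : R3 → ℝ) (i j : Fin 3) (x : R3) : R3 →L[ℝ] ℝ :=
  gradient φ x i • (EuclideanSpace.proj j : R3 →L[ℝ] ℝ) -
    gradient φ x j • (EuclideanSpace.proj i : R3 →L[ℝ] ℝ)

lemma curlForm_apply (φ : R3 → ℝ) (i j : Fin 3) (x v : R3) :
    curlForm φ i j x v = v j * gradient φ x i - v i * gradient φ x j := by
  rw [mul_comm (v j), mul_comm (v i)]
  rfl

lemma IsTest.isTestForm_curlForm {φ : R3 → ℝ} (h : IsTest φ) (i j : Fin 3) :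
    IsTestForm (curlForm φ i j) := by
  have hc : ∀ k : Fin 3, Continuous fun x => gradient φ x k := fun k =>
    (show Continuous fun z : R3 => z k by fun_prop).comp h.continuous_gradient
  exact ⟨((hc i).smul continuous_const).sub ((hc j).smul continuous_const),
    h.hasCompactSupport_gradient.comp_left (g := fun z : R3 =>
      z i • (EuclideanSpace.proj j : R3 →L[ℝ] ℝ) - z j • (EuclideanSpace.proj i : R3 →L[ℝ] ℝ))
      (by simp)⟩

section fieldOf
variable (η : Measure R3) [IsFiniteMeasure η]

lemma integrable_coulombField_prod (ρ : ℝ) :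
    Integrable (fun p : R3 × R3 => coulombField (p.1 - p.2))
      ((volume.restrict (Metric.ball 0 ρ)).prod η) := by
  have hm : Measurable (fun p : R3 × R3 => coulombField (p.1 - p.2)) := by fun_prop
  refine ⟨hm.aestronglyMeasurable, ?_⟩
  obtain ⟨C, hC, h⟩ := exists_lintegral_coulombField_sub_le ρ
  rw [HasFiniteIntegral, lintegral_prod_symm _ hm.enorm.aemeasurable]
  calc _ ≤ ∫⁻ _, C ∂η := lintegral_mono fun y => h y
    _ = C * η Set.univ := lintegral_const _
    _ < ⊤ := ENNReal.mul_lt_top hC.lt_top (measure_lt_top _ _)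

lemma integrableOn_fieldOf (ρ : ℝ) : IntegrableOn (fieldOf η) (Metric.ball 0 ρ) :=
  (integrable_coulombField_prod η ρ).integral_prod_left

lemma locallyIntegrable_of_forall_ball {f : R3 → R3}
    (h : ∀ n : ℕ, IntegrableOn f (Metric.ball 0 n)) : LocallyIntegrable f := by
  intro x
  obtain ⟨n, hn⟩ := exists_nat_gt ‖x‖
  exact ⟨Metric.ball 0 n, Metric.isOpen_ball.mem_nhds (by simpa using hn), h n⟩

/-- Fubini reduces weak identities for the field of η to those of a single point charge. -/
lemma IsTestForm.integral_apply_fieldOf {T : R3 → R3 →L[ℝ] ℝ} (hT : IsTestForm T) :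
    ∫ x, T x (fieldOf η x) = ∫ y, (∫ x, T x (coulombField (x - y))) ∂η := by
  obtain ⟨⟨M, hM⟩, ρ, -, hρ⟩ := hT.exists_bound
  have hint : Integrable (fun p : R3 × R3 => T p.1 (coulombField (p.1 - p.2)))
      ((volume.restrict (Metric.ball 0 ρ)).prod η) := by
    have hm : Measurable (fun p : R3 × R3 => coulombField (p.1 - p.2)) := by fun_prop
    have hm2 : Measurable (fun p : (R3 →L[ℝ] ℝ) × R3 => p.1 p.2) :=
      (isBoundedBilinearMap_apply (𝕜 := ℝ) (E := R3) (F := ℝ)).continuous.measurable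
    refine ((integrable_coulombField_prod η ρ).norm.const_mul M).mono'
      (hm2.comp ((hT.continuous.measurable.comp measurable_fst).prodMk hm)).aestronglyMeasurable
      (.of_forall fun p => ?_)
    exact ((T p.1).le_opNorm _).trans (mul_le_mul_of_nonneg_right (hM _) (norm_nonneg _))
  rw [IsTestForm.integral_apply_eq_setIntegral hρ]
  simp_rw [fun y => IsTestForm.integral_apply_eq_setIntegral hρ (fun x => coulombField (x - y))]
  rw [← integral_integral_swap hint]
  refine integral_congr_ae ?_
  filter_upwards [(integrable_coulombField_prod η ρ).prod_right_ae] with x hx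
  exact ((T x).integral_comp_comm hx).symm

lemma integral_inner_fieldOf {φ : R3 → ℝ} (h : IsTest φ) :
    ∫ x, inner ℝ (fieldOf η x) (gradient φ x) = -(4 * Real.pi * ∫ y, φ y ∂η) := by
  simp_rw [← divForm_apply, h.isTestForm_divForm.integral_apply_fieldOf η, divForm_apply,
    integral_inner_coulombField_sub h]
  rw [integral_neg, integral_const_mul]

lemma integral_curl_fieldOf {φ : R3 → ℝ} (h : IsTest φ) (i j : Fin 3) :
    ∫ x, (fieldOf η x j * gradient φ x i - fieldOf η x i * gradient φ x j) = 0 := by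
  simp_rw [← curlForm_apply, (h.isTestForm_curlForm i j).integral_apply_fieldOf η, curlForm_apply,
    integral_coulombField_sub_curl h]
  simp

end fieldOf

end

/-! ### Point counts and their Poisson moments. -/

section

/-- The weights satisfy (n + 1) p(n + 1) = r p(n). The choices g = 1 and g = n yield the first two
moments. -/
lemma lintegral_natCast_mul_poissonMeasure (r : NNReal) (g : ℕ → ℝ≥0∞) :
    ∫⁻ n, n * g n ∂(poissonMeasure r) = r * ∫⁻ n, g (n + 1) ∂(poissonMeasure r) := by
  rw [lintegral_countable', lintegral_countable', tsum_eq_zero_add' ENNReal.summable,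
    ← ENNReal.tsum_mul_left]
  simp only [Nat.cast_zero, zero_mul, zero_add]
  congr 1
  ext n
  have : ((n + 1 : ℕ) : ℝ≥0∞) * poissonMeasure r {n + 1} = r * poissonMeasure r {n} := by
    rw [poissonMeasure_singleton, poissonMeasure_singleton, ← ENNReal.ofReal_natCast,
      ← ENNReal.ofReal_coe_nnreal, ← ENNReal.ofReal_mul (by positivity),
      ← ENNReal.ofReal_mul (by positivity)]
    congr 1
    rw [Nat.factorial_succ]
    push_cast
    field_simp
    ring
  calc _ = g (n + 1) * (((n + 1 : ℕ) : ℝ≥0∞) * poissonMeasure r {n + 1}) := by ring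
    _ = _ := by rw [this]; ring

lemma lintegral_natCast_poissonMeasure (r : NNReal) :
    ∫⁻ n, (n : ℝ≥0∞) ∂(poissonMeasure r) = r := by
  simpa using lintegral_natCast_mul_poissonMeasure r (fun _ => 1)

lemma lintegral_natCast_sq_poissonMeasure (r : NNReal) :
    ∫⁻ n, (n : ℝ≥0∞) ^ 2 ∂(poissonMeasure r) = r ^ 2 + r := by
  have h := lintegral_natCast_mul_poissonMeasure r (fun n => n)
  simp only [← sq, Nat.cast_add, Nat.cast_one] at h
  rw [h, lintegral_add_right _ measurable_const, lintegral_natCast_poissonMeasure]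
  simp
  ring

variable {I : Finset ℝ}

lemma ChargedConfig.finite_setOf_mem (ω : ChargedConfig I) (q : I) {V : Set R3}
    (hV : Bornology.IsBounded V) : {x | x ∈ V ∧ (x, q) ∈ ω.carrier}.Finite := by
  refine ((ω.locallyFinite _ hV.isCompact_closure).image Prod.fst).subset ?_
  rintro x ⟨hx, hxω⟩
  exact ⟨(x, q), ⟨hxω, subset_closure hx⟩, rfl⟩

/-- The counting measure of the scatterers of charge `q` in `V`. -/
def ptMeasure (q : I) (V : Set R3) (ω : ChargedConfig I) : Measure R3 :=
  Measure.count.restrict {x | x ∈ V ∧ (x, q) ∈ ω.carrier}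

lemma ptMeasure_apply (q : I) {V : Set R3} (hV : Bornology.IsBounded V) (ω : ChargedConfig I)
    {A : Set R3} (hA : MeasurableSet A) : ptMeasure q V ω A = ω.count (V ∩ A) q := by
  have hfin : (A ∩ {x | x ∈ V ∧ (x, q) ∈ ω.carrier}).Finite :=
    (ω.finite_setOf_mem q hV).subset Set.inter_subset_right
  rw [ptMeasure, Measure.restrict_apply hA, Measure.count_apply_finite _ hfin,
    ← Set.ncard_eq_toFinset_card _ hfin, ChargedConfig.count]
  congr 2
  ext x
  simp only [Set.mem_inter_iff, Set.mem_ofPred_eq]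
  tauto

lemma ptMeasure_restrict (q : I) {V W : Set R3} (hW : MeasurableSet W) (h : W ⊆ V)
    (ω : ChargedConfig I) : (ptMeasure q V ω).restrict W = ptMeasure q W ω := by
  rw [ptMeasure, Measure.restrict_restrict hW, ptMeasure]
  congr 1
  ext x
  simp only [Set.mem_inter_iff, Set.mem_ofPred_eq]
  exact ⟨fun hx => ⟨hx.1, hx.2.2⟩, fun hx => ⟨hx.1, h hx.1, hx.2⟩⟩

lemma isFiniteMeasure_ptMeasure (q : I) {V : Set R3} (hV : Bornology.IsBounded V)
    (ω : ChargedConfig I) : IsFiniteMeasure (ptMeasure q V ω) :=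
  ⟨by rw [ptMeasure_apply q hV ω .univ]; exact ENNReal.natCast_lt_top _⟩

instance (q : I) (r : ℝ) (ω : ChargedConfig I) :
    IsFiniteMeasure (ptMeasure q (Metric.ball 0 r) ω) :=
  isFiniteMeasure_ptMeasure q Metric.isBounded_ball ω

/-- For an open set s, the mass of s is the count in the bounded open set ball ∩ s, which is
measurable by the definition of the σ-algebra; open sets form a π-system generating the Borel sets.
-/
lemma measurable_ptMeasure_ball (q : I) (r : ℝ) :
    Measurable (ptMeasure q (Metric.ball 0 r)) := by
  have hopen : ∀ s : Set R3, IsOpen s →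
      Measurable fun ω => ptMeasure q (Metric.ball 0 r) ω s := by
    intro s hs
    simp_rw [ptMeasure_apply q Metric.isBounded_ball _ hs.measurableSet]
    refine (measurable_from_top (f := fun n : ℕ => (n : ℝ≥0∞))).comp
      (measurable_to_countable' fun m => ?_)
    exact MeasurableSpace.measurableSet_generateFrom
      ⟨_, q, m, Metric.isOpen_ball.inter hs, Metric.isBounded_ball.subset Set.inter_subset_left,
        rfl⟩
  exact Measurable.measure_of_isPiSystem (BorelSpace.measurable_eq (α := R3)) isPiSystem_isOpen
    hopen (hopen _ isOpen_univ)

/-- The scatterers of charge `q` in a ball as a kernel. -/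
def ptKernel (q : I) (r : ℝ) : Kernel (ChargedConfig I) R3 :=
  ⟨ptMeasure q (Metric.ball 0 r), measurable_ptMeasure_ball q r⟩

lemma ptKernel_apply (q : I) (r : ℝ) (ω : ChargedConfig I) :
    ptKernel q r ω = ptMeasure q (Metric.ball 0 r) ω := rfl

instance (q : I) (r : ℝ) (ω : ChargedConfig I) : IsFiniteMeasure (ptKernel q r ω) :=
  inferInstanceAs (IsFiniteMeasure (ptMeasure q (Metric.ball 0 r) ω))

lemma exists_natCast_eq_ptKernel_univ (q : I) (r : ℝ) (ω : ChargedConfig I) :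
    ∃ n : ℕ, ptKernel q r ω Set.univ = n :=
  ⟨_, ptMeasure_apply q Metric.isBounded_ball ω .univ⟩

/-- The number of points in the ball is finite for each ω but has no uniform bound, so the kernel is
cut along the events of exactly n points. -/
instance (q : I) (r : ℝ) : IsSFiniteKernel (ptKernel q r) := by
  classical
  have hm : ∀ n : ℕ, MeasurableSet {ω | ptKernel q r ω Set.univ = n} := fun n =>
    (ptKernel q r).measurable_coe .univ (measurableSet_singleton _)
  have hfin : ∀ n : ℕ, IsFiniteKernel (Kernel.piecewise (hm n) (ptKernel q r) 0) := by
    intro n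
    refine ⟨n, ENNReal.natCast_lt_top _, fun ω => ?_⟩
    rw [Kernel.piecewise_apply']
    split_ifs with h
    · exact h.le
    · simp
  have hsum : ptKernel q r = Kernel.sum fun n => Kernel.piecewise (hm n) (ptKernel q r) 0 := by
    ext ω s hs
    obtain ⟨m, hω⟩ := exists_natCast_eq_ptKernel_univ q r ω
    rw [Kernel.sum_apply' _ _ hs, tsum_eq_single m]
    · rw [Kernel.piecewise_apply']
      exact (if_pos hω).symm
    · intro n hn
      rw [Kernel.piecewise_apply', if_neg]
      · simp
      · intro h
        rw [Set.mem_ofPred_eq, hω] at h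
        exact hn (by exact_mod_cast h.symm)
  rw [hsum]
  infer_instance

lemma measurable_count (q : I) {V : Set R3} (hV : MeasurableSet V)
    (hb : Bornology.IsBounded V) : Measurable fun ω : ChargedConfig I => ω.count V q := by
  obtain ⟨r, hr⟩ := hb.subset_ball 0
  refine measurable_to_countable' fun m => ?_
  have h : ∀ ω : ChargedConfig I, ptKernel q r ω V = ω.count V q := fun ω => by
    rw [ptKernel_apply, ptMeasure_apply q Metric.isBounded_ball ω hV,
      Set.inter_eq_right.2 hr]
  have : (fun ω : ChargedConfig I => ω.count V q) ⁻¹' {m} = {ω | ptKernel q r ω V = m} := by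
    ext ω
    simp [h]
  rw [this]
  exact (ptKernel q r).measurable_coe hV (measurableSet_singleton _)

section Poisson
variable {μ : PMF I} {P : Measure (ChargedConfig I)}

lemma IsPoissonLaw.map_count (hP : IsPoissonLaw μ P) (q : I) {V : Set R3}
    (hV : MeasurableSet V) (hb : Bornology.IsBounded V) :
    P.map (fun ω => ω.count V q) = poissonMeasure (μ q * volume V).toNNReal := by
  have hT : Measurable fun (ω : ChargedConfig I) (q : I) => ω.count V q :=
    measurable_pi_lambda _ fun q => measurable_count q hV hb
  have h : P.map (fun ω q => ω.count V q) =
      Measure.pi fun q => poissonMeasure (μ q * volume V).toNNReal := by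
    refine Measure.ext_of_singleton fun n => ?_
    rw [Measure.map_apply hT (measurableSet_singleton _), Measure.pi_singleton]
    have := hP 1 (fun _ => V) (fun _ => hV) (fun _ => hb)
      (fun i j hij => (hij (Subsingleton.elim i j)).elim) (fun _ => n)
    simp only [Fin.prod_univ_one, forall_const] at this
    rw [← this]
    congr 1
    ext ω
    simp [funext_iff]
  calc P.map (fun ω => ω.count V q)
      = (P.map (fun ω q => ω.count V q)).map (Function.eval q) := by
        rw [Measure.map_map (measurable_pi_apply q) hT]; rfl
    _ = _ := by rw [h, (measurePreserving_eval _ q).map_eq]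

lemma PMF.mul_volume_ne_top (q : I) {V : Set R3} (hb : Bornology.IsBounded V) :
    μ q * volume V ≠ ⊤ :=
  ENNReal.mul_ne_top (μ.apply_ne_top q) hb.measure_lt_top.ne

lemma IsPoissonLaw.lintegral_count (hP : IsPoissonLaw μ P) (q : I) {V : Set R3}
    (hV : MeasurableSet V) (hb : Bornology.IsBounded V) :
    ∫⁻ ω, (ω.count V q : ℝ≥0∞) ∂P = μ q * volume V := by
  rw [← lintegral_map (f := fun n : ℕ => (n : ℝ≥0∞)) measurable_from_top
    (measurable_count q hV hb), hP.map_count q hV hb, lintegral_natCast_poissonMeasure,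
    ENNReal.coe_toNNReal (PMF.mul_volume_ne_top q hb)]

lemma IsPoissonLaw.lintegral_count_sq (hP : IsPoissonLaw μ P) (q : I) {V : Set R3}
    (hV : MeasurableSet V) (hb : Bornology.IsBounded V) :
    ∫⁻ ω, (ω.count V q : ℝ≥0∞) ^ 2 ∂P = (μ q * volume V) ^ 2 + μ q * volume V := by
  rw [← lintegral_map (f := fun n : ℕ => (n : ℝ≥0∞) ^ 2) measurable_from_top
    (measurable_count q hV hb), hP.map_count q hV hb, lintegral_natCast_sq_poissonMeasure,
    ENNReal.coe_toNNReal (PMF.mul_volume_ne_top q hb)]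

lemma ChargedConfig.count_union (ω : ChargedConfig I) (q : I) {A B : Set R3}
    (hA : Bornology.IsBounded A) (hB : Bornology.IsBounded B) (h : Disjoint A B) :
    ω.count (A ∪ B) q = ω.count A q + ω.count B q := by
  rw [ChargedConfig.count, ChargedConfig.count, ChargedConfig.count,
    ← Set.ncard_union_eq _ (ω.finite_setOf_mem q hA) (ω.finite_setOf_mem q hB)]
  · congr 1
    ext x
    simp only [Set.mem_union, Set.mem_ofPred_eq]
    tauto
  · rw [Set.disjoint_left]
    rintro x ⟨hxA, -⟩ ⟨hxB, -⟩
    exact Set.disjoint_left.1 h hxA hxB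

/-- Polarization: the counts in A, B and A ∪ B are all Poisson, so comparing second moments isolates
the mixed term. Finite means make the cancellation in `ℝ≥0∞` legitimate. -/
lemma IsPoissonLaw.lintegral_count_mul_of_disjoint (hP : IsPoissonLaw μ P) (q : I)
    {A B : Set R3} (hA : MeasurableSet A) (hbA : Bornology.IsBounded A) (hB : MeasurableSet B)
    (hbB : Bornology.IsBounded B) (h : Disjoint A B) :
    ∫⁻ ω, (ω.count A q : ℝ≥0∞) * ω.count B q ∂P = (μ q * volume A) * (μ q * volume B) := by
  have mc : ∀ {V : Set R3}, MeasurableSet V → Bornology.IsBounded V →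
      Measurable fun ω : ChargedConfig I => (ω.count V q : ℝ≥0∞) := fun hV hb =>
    (measurable_from_top (f := fun n : ℕ => (n : ℝ≥0∞))).comp (measurable_count q hV hb)
  have hAB := hP.lintegral_count_sq q (hA.union hB) (hbA.union hbB)
  simp only [ChargedConfig.count_union _ q hbA hbB h, measure_union h hB, Nat.cast_add] at hAB
  have e1 : ∫⁻ ω, ((ω.count A q : ℝ≥0∞) + ω.count B q) ^ 2 ∂P =
      ∫⁻ ω, (ω.count A q : ℝ≥0∞) ^ 2 ∂P + ∫⁻ ω, (ω.count B q : ℝ≥0∞) ^ 2 ∂P +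
        2 * ∫⁻ ω, (ω.count A q : ℝ≥0∞) * ω.count B q ∂P := by
    have hm : Measurable fun ω : ChargedConfig I => (ω.count A q : ℝ≥0∞) * ω.count B q :=
      (mc hA hbA).mul (mc hB hbB)
    rw [← lintegral_const_mul _ hm,
      ← lintegral_add_right _ ((mc hB hbB).pow_const 2),
      ← lintegral_add_right _ (hm.const_mul 2)]
    refine lintegral_congr fun ω => ?_
    ring
  rw [e1, hP.lintegral_count_sq q hA hbA, hP.lintegral_count_sq q hB hbB] at hAB
  have fA := PMF.mul_volume_ne_top (μ := μ) q hbA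
  have fB := PMF.mul_volume_ne_top (μ := μ) q hbB
  rw [mul_add] at hAB
  set a := μ q * volume A
  set b := μ q * volume B
  have hfin : a ^ 2 + a + (b ^ 2 + b) ≠ ⊤ := by simp [fA, fB]
  have h2 : a ^ 2 + a + (b ^ 2 + b) + 2 * ∫⁻ ω, (ω.count A q : ℝ≥0∞) * ω.count B q ∂P =
      a ^ 2 + a + (b ^ 2 + b) + 2 * (a * b) := by
    rw [hAB]; ring
  exact (ENNReal.mul_right_inj two_ne_zero ENNReal.ofNat_ne_top).1
    ((ENNReal.add_right_inj hfin).1 h2)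

/-- Cutting into A \ B, A ∩ B and B \ A, only the square of the count in the overlap departs from a
product of means; its variance is the extra term. -/
lemma IsPoissonLaw.lintegral_count_mul (hP : IsPoissonLaw μ P) (q : I)
    {A B : Set R3} (hA : MeasurableSet A) (hbA : Bornology.IsBounded A) (hB : MeasurableSet B)
    (hbB : Bornology.IsBounded B) :
    ∫⁻ ω, (ω.count A q : ℝ≥0∞) * ω.count B q ∂P =
      (μ q * volume A) * (μ q * volume B) + μ q * volume (A ∩ B) := by
  have mc : ∀ {V : Set R3}, MeasurableSet V → Bornology.IsBounded V →
      Measurable fun ω : ChargedConfig I => (ω.count V q : ℝ≥0∞) := fun hV hb =>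
    (measurable_from_top (f := fun n : ℕ => (n : ℝ≥0∞))).comp (measurable_count q hV hb)
  have hu := hA.diff hB
  have hbu := hbA.subset (Set.sdiff_subset (t := B))
  have hw := hB.diff hA
  have hbw := hbB.subset (Set.sdiff_subset (t := A))
  have hv := hA.inter hB
  have hbv := hbA.subset (Set.inter_subset_left (t := B))
  have d1 : Disjoint (A \ B) (A ∩ B) := Set.disjoint_sdiff_inter
  have d2 : Disjoint (A ∩ B) (B \ A) :=
    Set.disjoint_left.2 fun x hx hx' => hx'.2 hx.1
  have d3 : Disjoint (A \ B) (B \ A) := Set.disjoint_left.2 fun x hx hx' => hx.2 hx'.1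
  have eA : A = (A \ B) ∪ (A ∩ B) := (Set.sdiff_union_inter A B).symm
  have eB : B = (A ∩ B) ∪ (B \ A) := by
    rw [Set.inter_comm, Set.union_comm]; exact (Set.sdiff_union_inter B A).symm
  have cA : ∀ ω : ChargedConfig I, ω.count A q = ω.count (A \ B) q + ω.count (A ∩ B) q :=
    fun ω => by rw [← ω.count_union q hbu hbv d1, ← eA]
  have cB : ∀ ω : ChargedConfig I, ω.count B q = ω.count (A ∩ B) q + ω.count (B \ A) q :=
    fun ω => by rw [← ω.count_union q hbv hbw d2, ← eB]
  have vA : volume A = volume (A \ B) + volume (A ∩ B) := by rw [← measure_union d1 hv, ← eA]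
  have vB : volume B = volume (A ∩ B) + volume (B \ A) := by rw [← measure_union d2 hw, ← eB]
  have m2 : Measurable fun ω : ChargedConfig I =>
      (ω.count (A \ B) q : ℝ≥0∞) * ω.count (B \ A) q := (mc hu hbu).mul (mc hw hbw)
  have m3 := (mc hv hbv).pow_const 2
  have m4 : Measurable fun ω : ChargedConfig I =>
      (ω.count (A ∩ B) q : ℝ≥0∞) * ω.count (B \ A) q := (mc hv hbv).mul (mc hw hbw)
  have e : ∫⁻ ω, (ω.count A q : ℝ≥0∞) * ω.count B q ∂P =
      ∫⁻ ω, (ω.count (A \ B) q : ℝ≥0∞) * ω.count (A ∩ B) q ∂P +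
      ∫⁻ ω, (ω.count (A \ B) q : ℝ≥0∞) * ω.count (B \ A) q ∂P +
      ∫⁻ ω, (ω.count (A ∩ B) q : ℝ≥0∞) ^ 2 ∂P +
      ∫⁻ ω, (ω.count (A ∩ B) q : ℝ≥0∞) * ω.count (B \ A) q ∂P := by
    rw [← lintegral_add_right _ m2, ← lintegral_add_right _ m3, ← lintegral_add_right _ m4]
    refine lintegral_congr fun ω => ?_
    rw [cA, cB]
    push_cast
    ring
  rw [e, hP.lintegral_count_mul_of_disjoint q hu hbu hv hbv d1,
    hP.lintegral_count_mul_of_disjoint q hu hbu hw hbw d3,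
    hP.lintegral_count_mul_of_disjoint q hv hbv hw hbw d2, hP.lintegral_count_sq q hv hbv, vA, vB]
  ring

end Poisson

end

/-! ### Campbell formulas and L¹ deviation bounds. -/

section

variable {I : Finset ℝ} {μ : PMF I} {P : Measure (ChargedConfig I)}

/-- The intensity measure of the scatterers of charge `q` in a ball. -/
def intensity (μ : PMF I) (q : I) (r : ℝ) : Measure R3 :=
  μ q • volume.restrict (Metric.ball 0 r)

lemma intensity_apply (q : I) (r : ℝ) {A : Set R3} (hA : MeasurableSet A) :
    intensity μ q r A = μ q * volume (Metric.ball 0 r ∩ A) := by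
  rw [intensity, Measure.smul_apply, Measure.restrict_apply hA, smul_eq_mul, Set.inter_comm]

instance (q : I) (r : ℝ) : IsFiniteMeasure (intensity μ q r) :=
  ⟨by rw [intensity_apply q r .univ]
      exact (PMF.mul_volume_ne_top q (Metric.isBounded_ball.subset Set.inter_subset_left)).lt_top⟩

lemma intensity_real_univ_le (q : I) (r : ℝ) :
    (intensity μ q r).real Set.univ ≤ volume.real (Metric.ball (0 : R3) r) := by
  rw [measureReal_def, measureReal_def, intensity_apply q r .univ, Set.inter_univ]
  refine ENNReal.toReal_mono measure_ball_lt_top.ne ?_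
  calc _ ≤ 1 * volume (Metric.ball (0 : R3) r) := by gcongr; exact μ.coe_le_one q
    _ = _ := one_mul _

lemma ptKernel_apply_count (q : I) (r : ℝ) (ω : ChargedConfig I) {A : Set R3}
    (hA : MeasurableSet A) : ptKernel q r ω A = ω.count (Metric.ball 0 r ∩ A) q :=
  ptMeasure_apply q Metric.isBounded_ball ω hA

lemma IsPoissonLaw.bind_ptKernel (hP : IsPoissonLaw μ P) (q : I) (r : ℝ) :
    P.bind (ptKernel q r) = intensity μ q r := by
  ext A hA
  rw [Measure.bind_apply hA (ptKernel q r).aemeasurable, intensity_apply q r hA]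
  simp_rw [ptKernel_apply_count q r _ hA]
  exact hP.lintegral_count q (measurableSet_ball.inter hA)
    (Metric.isBounded_ball.subset Set.inter_subset_left)

/-- The second moment measure is the product of intensities plus a diagonal part from pairs of equal
points. On rectangles this is the covariance of counts. -/
lemma IsPoissonLaw.bind_ptKernel_prod (hP : IsPoissonLaw μ P) (q : I) (r : ℝ) :
    P.bind ((ptKernel q r) ×ₖ (ptKernel q r)) =
      (intensity μ q r).prod (intensity μ q r) + (intensity μ q r).map (fun x => (x, x)) := by
  -- The explicit measure goes to the left because it is the one whose finiteness is at hand for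
  -- uniqueness from rectangles.
  symm
  have hd : Measurable fun x : R3 => (x, x) := measurable_id.prodMk measurable_id
  have : IsFiniteMeasure ((intensity μ q r).map (fun x => (x, x))) :=
    Measure.isFiniteMeasure_map _ _
  refine Measure.ext_prod fun {A B} hA hB => ?_
  rw [Measure.bind_apply (hA.prod hB) ((ptKernel q r) ×ₖ (ptKernel q r)).aemeasurable,
    Measure.add_apply, Measure.prod_prod, Measure.map_apply hd (hA.prod hB)]
  have hset : (fun x : R3 => (x, x)) ⁻¹' (A ×ˢ B) = A ∩ B := by ext; simp
  simp_rw [Kernel.prod_apply, Measure.prod_prod, ptKernel_apply_count q r _ hA,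
    ptKernel_apply_count q r _ hB]
  rw [hP.lintegral_count_mul q (measurableSet_ball.inter hA)
    (Metric.isBounded_ball.subset Set.inter_subset_left) (measurableSet_ball.inter hB)
    (Metric.isBounded_ball.subset Set.inter_subset_left), hset, intensity_apply q r hA,
    intensity_apply q r hB, intensity_apply q r (hA.inter hB), Set.inter_inter_distrib_left]

lemma IsPoissonLaw.lintegral_lintegral (hP : IsPoissonLaw μ P) (q : I) (r : ℝ) {f : R3 → ℝ≥0∞}
    (hf : Measurable f) :
    ∫⁻ ω, (∫⁻ x, f x ∂(ptKernel q r ω)) ∂P = ∫⁻ x, f x ∂(intensity μ q r) := by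
  rw [← hP.bind_ptKernel, Measure.lintegral_bind (ptKernel q r).aemeasurable hf.aemeasurable]

lemma IsPoissonLaw.lintegral_lintegral_sq (hP : IsPoissonLaw μ P) (q : I) (r : ℝ)
    {f : R3 → ℝ≥0∞} (hf : Measurable f) :
    ∫⁻ ω, (∫⁻ x, f x ∂(ptKernel q r ω)) ^ 2 ∂P =
      (∫⁻ x, f x ∂(intensity μ q r)) ^ 2 + ∫⁻ x, f x ^ 2 ∂(intensity μ q r) := by
  have hd : Measurable fun x : R3 => (x, x) := measurable_id.prodMk measurable_id
  have hff : Measurable fun p : R3 × R3 => f p.1 * f p.2 :=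
    (hf.comp measurable_fst).mul (hf.comp measurable_snd)
  have h := Measure.lintegral_bind (m := P) ((ptKernel q r) ×ₖ (ptKernel q r)).aemeasurable
    (f := fun p : R3 × R3 => f p.1 * f p.2) hff.aemeasurable
  rw [hP.bind_ptKernel_prod, lintegral_add_measure, lintegral_map hff hd,
    lintegral_prod_mul hf.aemeasurable hf.aemeasurable] at h
  simp_rw [Kernel.prod_apply, lintegral_prod_mul hf.aemeasurable hf.aemeasurable, ← sq] at h
  exact h.symm

section deviation
variable [IsProbabilityMeasure P]

lemma integrable_of_norm_le {E : Type*} [NormedAddCommGroup E] [MeasurableSpace E] [BorelSpace E]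
    [SecondCountableTopology E] {η : Measure R3} [IsFiniteMeasure η]
    {f : R3 → E} (hf : Measurable f) {C : ℝ} (hC : ∀ x, ‖f x‖ ≤ C) : Integrable f η :=
  (integrable_const C).mono' hf.aestronglyMeasurable (.of_forall hC)

lemma measurable_integral_ptKernel {E : Type*} [NormedAddCommGroup E] [NormedSpace ℝ E]
    [MeasurableSpace E] [BorelSpace E] [SecondCountableTopology E] (q : I) (r : ℝ) {f : R3 → E}
    (hf : Measurable f) : Measurable fun ω => ∫ x, f x ∂(ptKernel q r ω) :=
  (hf.stronglyMeasurable.integral_kernel (κ := ptKernel q r)).measurable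

/-- The variance is ∫ g² against the intensity, at most C² times the volume of the ball, and on a
probability space the L¹ norm is at most the L² norm. Nonnegativity lets the `ℝ≥0∞` Campbell
formulas apply. -/
lemma IsPoissonLaw.integral_abs_sub_le_of_nonneg (hP : IsPoissonLaw μ P) (q : I) (r : ℝ)
    {g : R3 → ℝ} (hg : Measurable g) (h0 : ∀ x, 0 ≤ g x) {C : ℝ} (hC : ∀ x, g x ≤ C) :
    ∫⁻ ω, ‖∫ x, g x ∂(ptKernel q r ω) - ∫ x, g x ∂(intensity μ q r)‖ₑ ∂P ≤
      ENNReal.ofReal (C * √(volume.real (Metric.ball (0 : R3) r))) := by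
  set X : ChargedConfig I → ℝ := fun ω => ∫ x, g x ∂(ptKernel q r ω)
  set m : ℝ := ∫ x, g x ∂(intensity μ q r)
  set V : ℝ := volume.real (Metric.ball (0 : R3) r)
  have hC0 : 0 ≤ C := (h0 0).trans (hC 0)
  have hnorm : ∀ x, ‖g x‖ ≤ C := fun x => by rw [Real.norm_of_nonneg (h0 x)]; exact hC x
  have hX0 : ∀ ω, 0 ≤ X ω := fun ω => integral_nonneg h0
  have hm0 : 0 ≤ m := integral_nonneg h0
  have hXm : Measurable X := measurable_integral_ptKernel q r hg
  have hXl : ∀ ω, ENNReal.ofReal (X ω) = ∫⁻ x, ENNReal.ofReal (g x) ∂(ptKernel q r ω) :=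
    fun ω => ofReal_integral_eq_lintegral_ofReal (integrable_of_norm_le hg hnorm) (.of_forall h0)
  have hml : ENNReal.ofReal m = ∫⁻ x, ENNReal.ofReal (g x) ∂(intensity μ q r) :=
    ofReal_integral_eq_lintegral_ofReal (integrable_of_norm_le hg hnorm) (.of_forall h0)
  have h2int : Integrable (fun x => g x ^ 2) (intensity μ q r) :=
    integrable_of_norm_le (hg.pow_const 2) (C := C ^ 2) fun x => by
      rw [norm_pow]; exact pow_le_pow_left₀ (norm_nonneg _) (hnorm x) 2
  have h2l : ENNReal.ofReal (∫ x, g x ^ 2 ∂(intensity μ q r)) =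
      ∫⁻ x, ENNReal.ofReal (g x) ^ 2 ∂(intensity μ q r) := by
    rw [ofReal_integral_eq_lintegral_ofReal h2int (.of_forall fun x => sq_nonneg _)]
    exact lintegral_congr fun x => ENNReal.ofReal_pow (h0 x) 2
  have e1 : ∫⁻ ω, ENNReal.ofReal (X ω) ∂P = ENNReal.ofReal m := by
    simp_rw [hXl, hml]
    exact hP.lintegral_lintegral q r hg.ennreal_ofReal
  have e2 : ∫⁻ ω, ENNReal.ofReal (X ω ^ 2) ∂P =
      ENNReal.ofReal (m ^ 2 + ∫ x, g x ^ 2 ∂(intensity μ q r)) := by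
    rw [ENNReal.ofReal_add (sq_nonneg _) (integral_nonneg fun x => sq_nonneg _), h2l,
      ENNReal.ofReal_pow hm0, hml]
    simp_rw [fun ω => ENNReal.ofReal_pow (hX0 ω) 2, hXl]
    exact hP.lintegral_lintegral_sq q r hg.ennreal_ofReal
  have iX : Integrable X P := ⟨hXm.aestronglyMeasurable, by
    rw [hasFiniteIntegral_iff_ofReal (.of_forall hX0), e1]; exact ENNReal.ofReal_lt_top⟩
  have iX2 : Integrable (fun ω => X ω ^ 2) P := ⟨(hXm.pow_const 2).aestronglyMeasurable, by
    rw [hasFiniteIntegral_iff_ofReal (.of_forall fun ω => sq_nonneg _), e2]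
    exact ENNReal.ofReal_lt_top⟩
  have E1 : ∫ ω, X ω ∂P = m := by
    rw [integral_eq_lintegral_of_nonneg_ae (.of_forall hX0) hXm.aestronglyMeasurable, e1,
      ENNReal.toReal_ofReal hm0]
  have E2 : ∫ ω, X ω ^ 2 ∂P = m ^ 2 + ∫ x, g x ^ 2 ∂(intensity μ q r) := by
    rw [integral_eq_lintegral_of_nonneg_ae (.of_forall fun ω => sq_nonneg _)
      (hXm.pow_const 2).aestronglyMeasurable, e2, ENNReal.toReal_ofReal]
    exact add_nonneg (sq_nonneg _) (integral_nonneg fun x => sq_nonneg _)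
  have hv : ∫ ω, (X ω - m) ^ 2 ∂P = ∫ x, g x ^ 2 ∂(intensity μ q r) := by
    have : ∀ ω, (X ω - m) ^ 2 = X ω ^ 2 - 2 * m * X ω + m ^ 2 := fun ω => by ring
    simp_rw [this]
    have i12 : Integrable (fun ω => X ω ^ 2 - 2 * m * X ω) P := iX2.sub (iX.const_mul _)
    rw [integral_add i12 (integrable_const _),
      integral_sub iX2 (iX.const_mul _), integral_const_mul, E1, E2]
    simp
    ring
  have hvle : ∫ ω, (X ω - m) ^ 2 ∂P ≤ C ^ 2 * V := by
    rw [hv]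
    calc ∫ x, g x ^ 2 ∂(intensity μ q r) ≤ ∫ _, C ^ 2 ∂(intensity μ q r) :=
          integral_mono h2int (integrable_const _) fun x => pow_le_pow_left₀ (h0 x) (hC x) 2
      _ = (intensity μ q r).real Set.univ * C ^ 2 := by rw [integral_const, smul_eq_mul]
      _ ≤ V * C ^ 2 := by gcongr; exact intensity_real_univ_le q r
      _ = _ := mul_comm _ _
  have hL2 : MemLp (fun ω => X ω - m) 2 P := by
    refine (memLp_two_iff_integrable_sq (hXm.sub_const m).aestronglyMeasurable).2 ?_
    have : ∀ ω, (X ω - m) ^ 2 = X ω ^ 2 - 2 * m * X ω + m ^ 2 := fun ω => by ring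
    simp_rw [this]
    exact (iX2.sub (iX.const_mul _)).add (integrable_const _)
  have hle := eLpNorm_le_eLpNorm_of_exponent_le (μ := P) (p := 1) (q := 2) (by norm_num)
    hL2.aestronglyMeasurable
  rw [eLpNorm_one_eq_lintegral_enorm] at hle
  refine hle.trans ?_
  rw [hL2.eLpNorm_eq_integral_rpow_norm two_ne_zero ENNReal.ofNat_ne_top]
  refine ENNReal.ofReal_le_ofReal ?_
  simp only [ENNReal.toReal_ofNat, Real.rpow_ofNat, Real.norm_eq_abs, sq_abs]
  rw [← one_div, ← Real.sqrt_eq_rpow]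
  calc √(∫ ω, (X ω - m) ^ 2 ∂P) ≤ √(C ^ 2 * V) := Real.sqrt_le_sqrt hvle
    _ = C * √V := by rw [Real.sqrt_mul (sq_nonneg _), Real.sqrt_sq hC0]

/-- The factor 2 pays for splitting g into positive and negative parts. -/
lemma IsPoissonLaw.integral_abs_sub_le (hP : IsPoissonLaw μ P) (q : I) (r : ℝ)
    {g : R3 → ℝ} (hg : Measurable g) {C : ℝ} (hC : ∀ x, |g x| ≤ C) :
    ∫⁻ ω, ‖∫ x, g x ∂(ptKernel q r ω) - ∫ x, g x ∂(intensity μ q r)‖ₑ ∂P ≤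
      2 * ENNReal.ofReal (C * √(volume.real (Metric.ball (0 : R3) r))) := by
  have hp : Measurable fun x => max (g x) 0 := hg.max measurable_const
  have hn : Measurable fun x => max (-g x) 0 := hg.neg.max measurable_const
  have hpC : ∀ x, max (g x) 0 ≤ C := fun x =>
    max_le ((le_abs_self _).trans (hC x)) ((abs_nonneg _).trans (hC x))
  have hnC : ∀ x, max (-g x) 0 ≤ C := fun x =>
    max_le ((neg_le_abs _).trans (hC x)) ((abs_nonneg _).trans (hC x))
  have hsplit : ∀ (η : Measure R3) [IsFiniteMeasure η],
      ∫ x, g x ∂η = ∫ x, max (g x) 0 ∂η - ∫ x, max (-g x) 0 ∂η := by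
    intro η _
    rw [← integral_sub
      (integrable_of_norm_le hp fun x => by rw [Real.norm_of_nonneg (le_max_right _ _)]; exact hpC x)
      (integrable_of_norm_le hn fun x => by
        rw [Real.norm_of_nonneg (le_max_right _ _)]; exact hnC x)]
    refine integral_congr_ae (.of_forall fun x => ?_)
    simp only
    rw [max_zero_sub_max_neg_zero_eq_self]
  have h1 := hP.integral_abs_sub_le_of_nonneg q r hp (fun x => le_max_right _ _) hpC
  have h2 := hP.integral_abs_sub_le_of_nonneg q r hn (fun x => le_max_right _ _) hnC
  rw [two_mul]
  refine le_trans ?_ (add_le_add h1 h2)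
  rw [← lintegral_add_right _ ((measurable_integral_ptKernel q r hn).sub_const _).enorm]
  refine lintegral_mono fun ω => ?_
  simp only
  rw [hsplit (ptKernel q r ω), hsplit (intensity μ q r)]
  refine le_trans (le_of_eq ?_) (enorm_sub_le (E := ℝ))
  congr 1
  ring

lemma enorm_le_sum_enorm_apply (v : R3) : ‖v‖ₑ ≤ ∑ i, ‖v i‖ₑ := by
  have h : v = ∑ i, v i • EuclideanSpace.single i (1 : ℝ) := by
    ext j
    simp [Pi.single_apply]
  calc ‖v‖ₑ = ‖∑ i, v i • EuclideanSpace.single i (1 : ℝ)‖ₑ := by rw [← h]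
    _ ≤ ∑ i, ‖v i • EuclideanSpace.single i (1 : ℝ)‖ₑ := enorm_sum_le _ _
    _ = _ := Finset.sum_congr rfl fun i _ => by
        rw [← ofReal_norm, ← ofReal_norm, norm_smul, PiLp.norm_single, norm_one, mul_one]

/-- Three coordinates at a factor 2 each give the constant 6. -/
lemma IsPoissonLaw.lintegral_enorm_sub_le (hP : IsPoissonLaw μ P) (q : I) (r : ℝ)
    {f : R3 → R3} (hf : Measurable f) {C : ℝ} (hC : ∀ x, ‖f x‖ ≤ C) :
    ∫⁻ ω, ‖∫ x, f x ∂(ptKernel q r ω) - ∫ x, f x ∂(intensity μ q r)‖ₑ ∂P ≤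
      6 * ENNReal.ofReal (C * √(volume.real (Metric.ball (0 : R3) r))) := by
  have hcoord : ∀ (η : Measure R3) [IsFiniteMeasure η] (i : Fin 3),
      (∫ x, f x ∂η) i = ∫ x, f x i ∂η := fun η _ i =>
    ((EuclideanSpace.proj i : R3 →L[ℝ] ℝ).integral_comp_comm (integrable_of_norm_le hf hC)).symm
  have hfi : ∀ i : Fin 3, Measurable fun x => f x i := fun i =>
    (show Measurable fun z : R3 => z i by fun_prop).comp hf
  calc _ ≤ ∫⁻ ω, ∑ i : Fin 3,
        ‖∫ x, f x i ∂(ptKernel q r ω) - ∫ x, f x i ∂(intensity μ q r)‖ₑ ∂P := by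
        refine lintegral_mono fun ω => (enorm_le_sum_enorm_apply _).trans (le_of_eq ?_)
        refine Finset.sum_congr rfl fun i _ => ?_
        rw [PiLp.sub_apply, hcoord, hcoord]
    _ = ∑ i : Fin 3, ∫⁻ ω,
        ‖∫ x, f x i ∂(ptKernel q r ω) - ∫ x, f x i ∂(intensity μ q r)‖ₑ ∂P :=
        lintegral_finsetSum _ fun i _ =>
          ((measurable_integral_ptKernel q r (hfi i)).sub_const _).enorm
    _ ≤ ∑ _i : Fin 3, 2 * ENNReal.ofReal (C * √(volume.real (Metric.ball (0 : R3) r))) :=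
        Finset.sum_le_sum fun i _ => hP.integral_abs_sub_le q r (hfi i) fun x =>
          (PiLp.norm_apply_le (f x) i).trans (hC x)
    _ = _ := by
        rw [Finset.sum_const, Finset.card_univ, Fintype.card_fin, nsmul_eq_mul, ← mul_assoc]
        norm_num

end deviation

end

/-! ### Centered fields and the annulus estimate. -/

section

variable {I : Finset ℝ} {μ : PMF I} {P : Measure (ChargedConfig I)}

lemma integrable_ptMeasure (q : I) {W : Set R3} (hW : Bornology.IsBounded W)
    (ω : ChargedConfig I) (f : R3 → R3) : Integrable f (ptMeasure q W ω) := by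
  have hfin := ω.finite_setOf_mem q hW
  have := isFiniteMeasure_ptMeasure q hW ω
  have h : IntegrableOn f {x | x ∈ W ∧ (x, q) ∈ ω.carrier} (ptMeasure q W ω) :=
    IntegrableOn.of_finite hfin
  rwa [IntegrableOn, ptMeasure, Measure.restrict_restrict hfin.measurableSet, Set.inter_self] at h

lemma integrableOn_coulombField_sub (x : R3) {W : Set R3} (hW : Bornology.IsBounded W) :
    IntegrableOn (fun y => coulombField (x - y)) W := by
  obtain ⟨r, hr⟩ := (hW.union (Bornology.isBounded_singleton (x := x))).subset_ball 0
  have h1 : IntegrableOn (fun y => coulombField (x - y)) (Metric.ball x (2 * r)) := by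
    have h2 := (integrableOn_coulombField_ball (2 * r)).integrable_indicator measurableSet_ball
    have h3 := h2.comp_sub_left x
    rw [← integrable_indicator_iff measurableSet_ball]
    refine h3.congr (.of_forall fun y => ?_)
    simp only [Set.indicator, Metric.mem_ball, dist_comm y x, dist_eq_norm, sub_zero]
  refine h1.mono_set fun y hy => ?_
  have hy' : ‖y‖ < r := by simpa using hr (Or.inl hy)
  have hx' : ‖x‖ < r := by simpa using hr (Or.inr rfl)
  rw [Metric.mem_ball, dist_eq_norm]
  linarith [norm_sub_le y x]

lemma fieldOf_ptMeasure (q : I) {W : Set R3} {r : ℝ} (hW : MeasurableSet W)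
    (h : W ⊆ Metric.ball 0 r) (ω : ChargedConfig I) (x : R3) :
    fieldOf (ptMeasure q W ω) x =
      ∫ y, W.indicator (fun y => coulombField (x - y)) y ∂(ptKernel q r ω) := by
  rw [integral_indicator hW, ptKernel_apply, ptMeasure_restrict q hW h, fieldOf]

lemma measurable_fieldOf_ptMeasure (q : I) {W : Set R3} (hW : MeasurableSet W)
    (hb : Bornology.IsBounded W) :
    Measurable fun p : R3 × ChargedConfig I => fieldOf (ptMeasure q W p.2) p.1 := by
  obtain ⟨r, hr⟩ := hb.subset_ball 0
  simp_rw [fun p : R3 × ChargedConfig I => fieldOf_ptMeasure q hW hr p.2 p.1]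
  have hm : Measurable (Function.uncurry fun (p : R3 × ChargedConfig I) (y : R3) =>
      W.indicator (fun y => coulombField (p.1 - y)) y) := by
    have : (Function.uncurry fun (p : R3 × ChargedConfig I) (y : R3) =>
        W.indicator (fun y => coulombField (p.1 - y)) y) =
        (Prod.snd ⁻¹' W).indicator
          (fun z : (R3 × ChargedConfig I) × R3 => coulombField (z.1.1 - z.2)) := by
      rfl
    rw [this]
    exact Measurable.indicator (by fun_prop) (measurable_snd hW)
  exact (hm.stronglyMeasurable.integral_kernel_prod_right
    (κ := Kernel.prodMkLeft R3 (ptKernel q r))).measurable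

lemma measurable_fieldOf (η : Measure R3) [SFinite η] : Measurable (fieldOf η) := by
  have hm : Measurable (Function.uncurry fun (x y : R3) => coulombField (x - y)) := by
    unfold Function.uncurry; fun_prop
  exact hm.stronglyMeasurable.integral_prod_right.measurable

/-- The field of the scatterers in `W`, with the field of their mean density subtracted. -/
def centeredField (μ : PMF I) (W : Set R3) (x : R3) (ω : ChargedConfig I) : R3 :=
  ∑ q : I, (q : ℝ) • (fieldOf (ptMeasure q W ω) x -
    (μ q).toReal • fieldOf (volume.restrict W) x)

lemma measurable_centeredField (μ : PMF I) {W : Set R3} (hW : MeasurableSet W)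
    (hb : Bornology.IsBounded W) : Measurable (Function.uncurry (centeredField μ W)) := by
  unfold Function.uncurry centeredField
  refine Finset.measurable_sum _ fun q _ => ?_
  have h1 : Measurable fun p : R3 × ChargedConfig I => fieldOf (volume.restrict W) p.1 :=
    (measurable_fieldOf (volume.restrict W)).comp measurable_fst
  exact ((measurable_fieldOf_ptMeasure q hW hb).sub (h1.const_smul (μ q).toReal)).const_smul (q : ℝ)

lemma centeredField_sub (μ : PMF I) {V W : Set R3} (hV : MeasurableSet V)
    (hb : Bornology.IsBounded W) (h : V ⊆ W) (hW : MeasurableSet W) (x : R3)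
    (ω : ChargedConfig I) :
    centeredField μ W x ω - centeredField μ V x ω = centeredField μ (W \ V) x ω := by
  have hd := hW.diff hV
  have hbd := hb.subset (Set.sdiff_subset (t := V))
  have e1 : fieldOf (volume.restrict W) x =
      fieldOf (volume.restrict (W \ V)) x + fieldOf (volume.restrict V) x := by
    unfold fieldOf
    rw [← setIntegral_union Set.disjoint_sdiff_left hV (integrableOn_coulombField_sub x hbd)
      (integrableOn_coulombField_sub x (hb.subset h)), Set.sdiff_union_of_subset h]
  have e2 : ∀ q : I, fieldOf (ptMeasure q W ω) x =
      fieldOf (ptMeasure q (W \ V) ω) x + fieldOf (ptMeasure q V ω) x := by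
    intro q
    unfold fieldOf
    rw [← ptMeasure_restrict q hd Set.sdiff_subset, ← ptMeasure_restrict q hV h,
      ← setIntegral_union Set.disjoint_sdiff_left hV (integrable_ptMeasure q hb ω _).integrableOn
      (integrable_ptMeasure q hb ω _).integrableOn, Set.sdiff_union_of_subset h,
      ptMeasure_restrict q hW subset_rfl]
  unfold centeredField
  rw [← Finset.sum_sub_distrib]
  refine Finset.sum_congr rfl fun q _ => ?_
  rw [e1, e2 q]
  module

lemma volume_real_ball (r : ℝ) (hr : 0 ≤ r) :
    volume.real (Metric.ball (0 : R3) r) = r ^ 3 * (Real.pi * 4 / 3) := by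
  rw [measureReal_def, EuclideanSpace.volume_ball_fin_three, ← ENNReal.ofReal_pow hr,
    ← ENNReal.ofReal_mul (by positivity), ENNReal.toReal_ofReal (by positivity)]

/-- The constant in the `L¹` bound for centered fields of annuli. -/
def annulusConst (I : Finset ℝ) : ℝ := 24 * √(Real.pi * 4 / 3) * ∑ q : I, |(q : ℝ)|

/-- For y in W one has ‖x - y‖ ≥ a/2, so the kernel is at most 4/a², while the intensity lives in a
ball of volume O(b³). The 24 in `annulusConst` is 6 · 4. -/
lemma IsPoissonLaw.lintegral_enorm_centeredField_le [IsProbabilityMeasure P]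
    (hP : IsPoissonLaw μ P) {W : Set R3} (hW : MeasurableSet W) {a b : ℝ} (ha : 0 < a)
    (hb : 0 ≤ b) (hWb : W ⊆ Metric.ball 0 b) (hWa : Disjoint W (Metric.ball 0 a)) {x : R3}
    (hx : ‖x‖ ≤ a / 2) :
    ∫⁻ ω, ‖centeredField μ W x ω‖ₑ ∂P ≤
      ENNReal.ofReal (annulusConst I * (√(b ^ 3) / a ^ 2)) := by
  set f : R3 → R3 := W.indicator fun y => coulombField (x - y)
  have hf : Measurable f := Measurable.indicator (by fun_prop) hW
  have hC : ∀ y, ‖f y‖ ≤ 4 / a ^ 2 := by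
    intro y
    by_cases hy : y ∈ W
    · have hya : a ≤ ‖y‖ := by
        simpa using Set.disjoint_left.1 hWa hy
      have hxy : a / 2 ≤ ‖x - y‖ := by
        have := norm_sub_norm_le y x
        rw [norm_sub_rev] at this
        linarith
      simp only [f, Set.indicator_of_mem hy]
      rw [norm_coulombField]
      calc (‖x - y‖ ^ 2)⁻¹ ≤ ((a / 2) ^ 2)⁻¹ := by gcongr
        _ = 4 / a ^ 2 := by field_simp; norm_num
    · simp only [f, Set.indicator_of_notMem hy, norm_zero]
      positivity
  have hint : ∀ q : I, ∫ y, f y ∂(intensity μ q b) =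
      (μ q).toReal • fieldOf (volume.restrict W) x := by
    intro q
    rw [intensity, integral_smul_measure, integral_indicator hW,
      Measure.restrict_restrict hW, Set.inter_eq_left.2 hWb, fieldOf]
  have key : ∀ ω, ‖centeredField μ W x ω‖ₑ ≤ ∑ q : I, ‖(q : ℝ)‖ₑ *
      ‖∫ y, f y ∂(ptKernel q b ω) - ∫ y, f y ∂(intensity μ q b)‖ₑ := by
    intro ω
    refine (enorm_sum_le _ _).trans (le_of_eq (Finset.sum_congr rfl fun q _ => ?_))
    rw [enorm_smul, hint, fieldOf_ptMeasure q hW hWb]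
  have hm : ∀ q : I, Measurable fun ω =>
      ‖∫ y, f y ∂(ptKernel q b ω) - ∫ y, f y ∂(intensity μ q b)‖ₑ := fun q =>
    ((measurable_integral_ptKernel q b hf).sub_const _).enorm
  calc ∫⁻ ω, ‖centeredField μ W x ω‖ₑ ∂P
      ≤ ∑ q : I, ∫⁻ ω, ‖(q : ℝ)‖ₑ *
        ‖∫ y, f y ∂(ptKernel q b ω) - ∫ y, f y ∂(intensity μ q b)‖ₑ ∂P := by
        rw [← lintegral_finsetSum _ fun q _ => (hm q).const_mul _]
        exact lintegral_mono key
    _ ≤ ∑ q : I, ENNReal.ofReal |(q : ℝ)| *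
        (6 * ENNReal.ofReal (4 / a ^ 2 * √(volume.real (Metric.ball (0 : R3) b)))) := by
        refine Finset.sum_le_sum fun q _ => ?_
        rw [lintegral_const_mul _ (hm q), ← Real.norm_eq_abs, ofReal_norm]
        gcongr
        exact hP.lintegral_enorm_sub_le q b hf hC
    _ = _ := by
        rw [← Finset.sum_mul, ← ENNReal.ofReal_sum_of_nonneg fun q _ => abs_nonneg _,
          volume_real_ball b hb, ← ENNReal.ofReal_ofNat 6, ← ENNReal.ofReal_mul (by norm_num),
          ← ENNReal.ofReal_mul (by positivity), annulusConst, Real.sqrt_mul (by positivity)]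
        congr 1
        ring

end

/-! ### Convergence along dyadic balls. -/

section

/-- Summable L¹ increments make the sequence Cauchy almost everywhere, and the tail sums bound the
L¹ distance to the limit. It serves twice: in ω for fixed x, and in x over a ball for fixed ω;
`limUnder` gives both the same pointwise limit. The shift k is there because the increment bounds
begin only at large radii. -/
lemma ae_tendsto_limUnder_and_tendsto_lintegral {X : Type*} [MeasurableSpace X] {ν : Measure X}
    {g : ℕ → X → R3} (hg : ∀ n, Measurable (g n)) (k : ℕ)
    (h : ∑' n, ∫⁻ x, ‖g (k + n + 1) x - g (k + n) x‖ₑ ∂ν ≠ ⊤) :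
    (∀ᵐ x ∂ν, Tendsto (fun n => g n x) atTop (𝓝 (limUnder atTop fun n => g n x))) ∧
    Tendsto (fun n => ∫⁻ x, ‖(limUnder atTop fun n => g n x) - g n x‖ₑ ∂ν) atTop (𝓝 0) := by
  set d : ℕ → X → ℝ≥0∞ := fun n x => ‖g (k + n + 1) x - g (k + n) x‖ₑ
  have hd : ∀ n, Measurable (d n) := fun n => ((hg _).sub (hg _)).enorm
  have hed : ∀ x n, edist (g (k + n) x) (g (k + n.succ) x) ≤ d n x := fun x n => by
    rw [edist_comm, edist_eq_enorm_sub]; rfl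
  have hsum : ∫⁻ x, ∑' n, d n x ∂ν ≠ ⊤ := by
    rwa [lintegral_tsum fun n => (hd n).aemeasurable]
  have hae : ∀ᵐ x ∂ν, Tendsto (fun n => g n x) atTop (𝓝 (limUnder atTop fun n => g n x)) := by
    filter_upwards [ae_lt_top (Measurable.tsum hd) hsum] with x hx
    have hc := cauchySeq_of_edist_le_of_tsum_ne_top (fun n => d n x) (hed x) hx.ne
    obtain ⟨l, hl⟩ := cauchySeq_tendsto_of_complete hc
    have hl' : Tendsto (fun n => g n x) atTop (𝓝 l) := by
      refine (tendsto_add_atTop_iff_nat k).1 ?_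
      simpa only [add_comm] using hl
    rw [hl'.limUnder_eq]
    exact hl'
  refine ⟨hae, (tendsto_add_atTop_iff_nat k).1 ?_⟩
  refine tendsto_of_tendsto_of_tendsto_of_le_of_le tendsto_const_nhds
    (ENNReal.tendsto_sum_nat_add _ h) (fun n => zero_le) fun n => ?_
  calc ∫⁻ x, ‖(limUnder atTop fun n => g n x) - g (n + k) x‖ₑ ∂ν
      ≤ ∫⁻ x, ∑' m, d (m + n) x ∂ν := by
        refine lintegral_mono_ae ?_
        filter_upwards [hae] with x hx
        have hx' : Tendsto (fun n => g (k + n) x) atTop (𝓝 (limUnder atTop fun n => g n x)) := by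
          simpa only [add_comm] using (tendsto_add_atTop_iff_nat k).2 hx
        have := edist_le_tsum_of_edist_le_of_tendsto (fun n => d n x) (hed x) hx' n
        rw [edist_comm, edist_eq_enorm_sub] at this
        simpa only [add_comm] using this
    _ = _ := lintegral_tsum fun m => (hd _).aemeasurable

variable {I : Finset ℝ} {μ : PMF I} {P : Measure (ChargedConfig I)}

/-- The centered field of the scatterers in the ball of radius `2 ^ n`. -/
def dyadicField (μ : PMF I) (n : ℕ) : R3 → ChargedConfig I → R3 :=
  centeredField μ (Metric.ball 0 (2 ^ n))

/-- The limit of the centered fields of dyadic balls. -/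
def limitField (μ : PMF I) (x : R3) (ω : ChargedConfig I) : R3 :=
  limUnder atTop fun n => dyadicField μ n x ω

lemma measurable_dyadicField (μ : PMF I) (n : ℕ) :
    Measurable (Function.uncurry (dyadicField μ n)) :=
  measurable_centeredField μ measurableSet_ball Metric.isBounded_ball

lemma measurable_limitField (μ : PMF I) : Measurable (Function.uncurry (limitField μ)) :=
  (StronglyMeasurable.limUnder (l := atTop)
    fun n => (measurable_dyadicField μ n).stronglyMeasurable).measurable

section
variable [IsProbabilityMeasure P]

/-- The difference is the centered field of W minus a ball, to which the annulus bound applies with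
a = 2ⁿ and b = M 2ⁿ. The ratio √8 / 4 is 2^(-1/2). -/
lemma IsPoissonLaw.lintegral_enorm_sub_dyadicField_le (hP : IsPoissonLaw μ P) {W : Set R3}
    (hW : MeasurableSet W) {n : ℕ} {M : ℝ} (hM : 0 ≤ M)
    (h1 : Metric.ball (0 : R3) (2 ^ n) ⊆ W) (h2 : W ⊆ Metric.ball 0 (M * 2 ^ n))
    {x : R3} (hx : ‖x‖ ≤ 2 ^ n / 2) :
    ∫⁻ ω, ‖centeredField μ W x ω - dyadicField μ n x ω‖ₑ ∂P ≤
      ENNReal.ofReal (annulusConst I * √(M ^ 3) * (√8 / 4) ^ n) := by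
  have hb : Bornology.IsBounded W := Metric.isBounded_ball.subset h2
  simp_rw [dyadicField, centeredField_sub μ measurableSet_ball hb h1 hW]
  refine (hP.lintegral_enorm_centeredField_le (hW.diff measurableSet_ball) (a := 2 ^ n)
    (b := M * 2 ^ n) (by positivity) (by positivity) (Set.sdiff_subset.trans h2)
    Set.disjoint_sdiff_left hx).trans (le_of_eq ?_)
  congr 1
  have e : (M * 2 ^ n) ^ 3 = M ^ 3 * 8 ^ n := by
    rw [mul_pow, ← pow_mul, mul_comm n 3, pow_mul]; norm_num
  have e2 : √((8 : ℝ) ^ n) = √8 ^ n := by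
    rw [← Real.sqrt_sq (pow_nonneg (Real.sqrt_nonneg 8) n), ← pow_mul, mul_comm n 2, pow_mul,
      Real.sq_sqrt (by norm_num)]
  rw [e, Real.sqrt_mul (by positivity), e2, div_pow, ← pow_mul, mul_comm n 2, pow_mul]
  norm_num
  ring

lemma sqrt_eight_div_four_lt_one : √8 / 4 < 1 := by
  rw [div_lt_one (by norm_num), Real.sqrt_lt' (by norm_num)]; norm_num

lemma tsum_ofReal_geometric_ne_top (A : ℝ) :
    ∑' n : ℕ, ENNReal.ofReal (A * (√8 / 4) ^ n) ≠ ⊤ :=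
  ((summable_geometric_of_lt_one (by positivity) sqrt_eight_div_four_lt_one).mul_left
    A).tsum_ofReal_ne_top

lemma IsPoissonLaw.lintegral_enorm_dyadicField_succ_sub_le (hP : IsPoissonLaw μ P) {n : ℕ}
    {x : R3} (hx : ‖x‖ ≤ 2 ^ n / 2) :
    ∫⁻ ω, ‖dyadicField μ (n + 1) x ω - dyadicField μ n x ω‖ₑ ∂P ≤
      ENNReal.ofReal (annulusConst I * √(2 ^ 3) * (√8 / 4) ^ n) :=
  hP.lintegral_enorm_sub_dyadicField_le measurableSet_ball (by norm_num)
    (Metric.ball_subset_ball (by gcongr <;> norm_num))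
    (Metric.ball_subset_ball (by rw [pow_succ, mul_comm])) hx

lemma exists_le_two_pow_add_div_two (ρ : ℝ) : ∃ k : ℕ, ∀ n, ρ ≤ 2 ^ (k + n) / 2 := by
  obtain ⟨k, hk⟩ := pow_unbounded_of_one_lt (2 * ρ) (one_lt_two (α := ℝ))
  refine ⟨k, fun n => ?_⟩
  have : (2 : ℝ) ^ k ≤ 2 ^ (k + n) := pow_le_pow_right₀ one_le_two (Nat.le_add_right _ _)
  linarith

lemma tsum_ofReal_geometric_add_ne_top (A : ℝ) (k : ℕ) :
    ∑' n : ℕ, ENNReal.ofReal (A * (√8 / 4) ^ (k + n)) ≠ ⊤ := by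
  have : ∀ n, A * (√8 / 4) ^ (k + n) = (A * (√8 / 4) ^ k) * (√8 / 4) ^ n := fun n => by
    rw [pow_add]; ring
  simp_rw [this]
  exact tsum_ofReal_geometric_ne_top _

lemma IsPoissonLaw.tendsto_lintegral_limitField_sub (hP : IsPoissonLaw μ P) (x : R3) :
    Tendsto (fun n => ∫⁻ ω, ‖limitField μ x ω - dyadicField μ n x ω‖ₑ ∂P) atTop (𝓝 0) := by
  obtain ⟨k, hk⟩ := exists_le_two_pow_add_div_two ‖x‖
  have hsum : ∑' n, ∫⁻ ω, ‖dyadicField μ (k + n + 1) x ω - dyadicField μ (k + n) x ω‖ₑ ∂P ≠ ⊤ :=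
    ne_top_of_le_ne_top (tsum_ofReal_geometric_add_ne_top (annulusConst I * √(2 ^ 3)) k)
      (ENNReal.tsum_le_tsum fun n => hP.lintegral_enorm_dyadicField_succ_sub_le (hk n))
  have hm : ∀ n, Measurable (dyadicField μ n x) := fun n =>
    (measurable_dyadicField μ n).of_uncurry_left
  exact (ae_tendsto_limUnder_and_tendsto_lintegral hm k hsum).2

/-- The increment bound is uniform for x in the ball, so by Tonelli the L¹ norms of the increments
over the ball have summable expectation, hence are almost surely summable. -/
lemma IsPoissonLaw.ae_tendsto_setLIntegral_limitField_sub (hP : IsPoissonLaw μ P) (ρ : ℝ) :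
    ∀ᵐ ω ∂P, Tendsto (fun n => ∫⁻ x in Metric.ball (0 : R3) ρ,
      ‖limitField μ x ω - dyadicField μ n x ω‖ₑ) atTop (𝓝 0) := by
  obtain ⟨k, hk⟩ := exists_le_two_pow_add_div_two ρ
  set A : ℝ := annulusConst I * √(2 ^ 3)
  set D : ℕ → R3 × ChargedConfig I → ℝ≥0∞ := fun n p =>
    ‖dyadicField μ (k + n + 1) p.1 p.2 - dyadicField μ (k + n) p.1 p.2‖ₑ
  have hD : ∀ n, Measurable (D n) := fun n =>
    ((measurable_dyadicField μ _).sub (measurable_dyadicField μ _)).enorm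
  have hDω : ∀ n, Measurable fun ω => ∫⁻ x in Metric.ball (0 : R3) ρ, D n (x, ω) := fun n =>
    (hD n).lintegral_prod_left'
  have hle : ∀ n, ∫⁻ ω, (∫⁻ x in Metric.ball (0 : R3) ρ, D n (x, ω)) ∂P ≤
      volume (Metric.ball (0 : R3) ρ) * ENNReal.ofReal (A * (√8 / 4) ^ (k + n)) := by
    intro n
    rw [lintegral_lintegral_swap (f := fun ω x => D n (x, ω))
      ((hD n).comp measurable_swap).aemeasurable]
    calc ∫⁻ x in Metric.ball (0 : R3) ρ, (∫⁻ ω, D n (x, ω) ∂P)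
        ≤ ∫⁻ _ in Metric.ball (0 : R3) ρ, ENNReal.ofReal (A * (√8 / 4) ^ (k + n)) := by
          refine setLIntegral_mono measurable_const fun x hx => ?_
          refine hP.lintegral_enorm_dyadicField_succ_sub_le (le_trans ?_ (hk n))
          simpa using (Metric.mem_ball.1 hx).le
      _ = _ := by rw [setLIntegral_const, mul_comm]
  have hsum : ∫⁻ ω, ∑' n, (∫⁻ x in Metric.ball (0 : R3) ρ, D n (x, ω)) ∂P ≠ ⊤ := by
    rw [lintegral_tsum fun n => (hDω n).aemeasurable]
    refine ne_top_of_le_ne_top ?_ (ENNReal.tsum_le_tsum hle)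
    rw [ENNReal.tsum_mul_left]
    exact ENNReal.mul_ne_top measure_ball_lt_top.ne (tsum_ofReal_geometric_add_ne_top _ k)
  filter_upwards [ae_lt_top (Measurable.tsum hDω) hsum] with ω hω
  have hm : ∀ n, Measurable fun x => dyadicField μ n x ω := fun n =>
    (measurable_dyadicField μ n).of_uncurry_right
  exact (ae_tendsto_limUnder_and_tendsto_lintegral hm k hω.ne).2

end

end

/-! ### The deterministic background field of the dilated domain. -/

section

lemma contDiffAt_coulombField {z : R3} (hz : z ≠ 0) : ContDiffAt ℝ 1 coulombField z := by
  unfold coulombField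
  exact (((contDiffAt_norm ℝ hz).pow 3).inv (pow_ne_zero _ (norm_ne_zero_iff.2 hz))).smul
    contDiffAt_id

lemma locallyIntegrable_coulombField_sub (x : R3) :
    LocallyIntegrable fun y => coulombField (x - y) :=
  locallyIntegrable_of_forall_ball fun _ => integrableOn_coulombField_sub x Metric.isBounded_ball

open Convolution in
-- Split the indicator of U as a bump χ plus a remainder h vanishing near 0. The convolution K ∗ χ
-- is differentiable because χ is smooth; for x near 0 the term h ∗ K involves K only away from its
-- singularity and in a bounded range, where K agrees with a compactly supported C¹ function g.
lemma differentiableAt_fieldOf_restrict {U : Set R3} (hU : IsOpen U)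
    (hb : Bornology.IsBounded U) (h0 : 0 ∈ U) :
    DifferentiableAt ℝ (fieldOf (volume.restrict U)) 0 := by
  obtain ⟨ε, hε, hεU⟩ := Metric.isOpen_iff.1 hU 0 h0
  obtain ⟨M, hM⟩ := hb.subset_ball 0
  have hM0 : 0 < M := by simpa using hM h0
  set s : ℝ := ε / 2
  have hs : 0 < s := by positivity
  -- Where h ≠ 0 one has s < ‖y‖ < M, so ‖x‖ < s/2 forces s/2 < ‖x - y‖ < M + s: there `β` vanishes
  -- and `κ` equals 1.
  let χ : ContDiffBump (0 : R3) := ⟨s, ε, hs, half_lt_self hε⟩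
  let β : ContDiffBump (0 : R3) := ⟨s / 4, s / 2, by positivity, by linarith⟩
  let κ : ContDiffBump (0 : R3) := ⟨M + s, M + s + 1, by positivity, by linarith⟩
  set g : R3 → R3 := fun z => κ z • ((1 - β z) • coulombField z)
  set h : R3 → ℝ := fun y => U.indicator (fun _ => (1 : ℝ)) y - χ y
  have hg : ContDiff ℝ 1 g := by
    rw [contDiff_iff_contDiffAt]
    intro z
    by_cases hz : z = 0
    · have : g =ᶠ[𝓝 z] fun _ => 0 := by
        rw [hz]
        filter_upwards [β.eventuallyEq_one] with w hw
        simp [g, hw]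
      exact contDiffAt_const.congr_of_eventuallyEq this
    · exact κ.contDiffAt.smul ((contDiffAt_const.sub β.contDiffAt).smul
        (contDiffAt_coulombField hz))
  have hgc : HasCompactSupport g := κ.hasCompactSupport.smul_right
  have iχ : Integrable (fun y => χ y) := χ.continuous.integrable_of_hasCompactSupport
    χ.hasCompactSupport
  have iU : Integrable (U.indicator fun _ => (1 : ℝ)) :=
    (integrable_indicator_iff hU.measurableSet).2 (by simpa using hb.measure_lt_top)
  have hh : LocallyIntegrable h := (iU.sub iχ).locallyIntegrable
  set A : R3 → R3 := coulombField ⋆[(ContinuousLinearMap.lsmul ℝ ℝ).flip, volume] χ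
  set B : R3 → R3 := h ⋆[ContinuousLinearMap.lsmul ℝ ℝ, volume] g
  have dA : DifferentiableAt ℝ A 0 :=
    (χ.hasCompactSupport.hasFDerivAt_convolution_right
      (ContinuousLinearMap.lsmul ℝ ℝ).flip locallyIntegrable_coulombField
      χ.contDiff 0).differentiableAt
  have dB : DifferentiableAt ℝ B 0 :=
    (hgc.hasFDerivAt_convolution_right (ContinuousLinearMap.lsmul ℝ ℝ) hh hg 0).differentiableAt
  have heq : fieldOf (volume.restrict U) =ᶠ[𝓝 0] fun x => A x + B x := by
    filter_upwards [Metric.ball_mem_nhds (0 : R3) (half_pos hs)] with x hx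
    have hx : ‖x‖ < s / 2 := by simpa using hx
    have hA : A x = ∫ y, χ y • coulombField (x - y) := by
      simp only [A, convolution_def, ContinuousLinearMap.flip_apply,
        ContinuousLinearMap.lsmul_apply]
      rw [← integral_sub_left_eq_self _ volume x]
      simp
    have hB : B x = ∫ y, h y • coulombField (x - y) := by
      simp only [B, convolution_def, ContinuousLinearMap.lsmul_apply]
      refine integral_congr_ae (.of_forall fun y => ?_)
      by_cases hy : h y = 0
      · simp [hy]
      · have hyU : y ∈ U := by
          by_contra hyU
          refine hy ?_
          have : χ y = 0 := χ.zero_of_le_dist (le_of_not_gt fun hlt => hyU (hεU hlt))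
          simp [h, hyU, this]
        have hys : s < ‖y‖ := by
          by_contra hle
          refine hy ?_
          have : χ y = 1 := χ.one_of_mem_closedBall (by simpa using le_of_not_gt hle)
          simp [h, hyU, this]
        have hyM : ‖y‖ < M := by simpa using hM hyU
        have hβ : β (x - y) = 0 := β.zero_of_le_dist (by
          have := norm_sub_norm_le y x
          rw [norm_sub_rev] at this
          simp only [dist_zero_right, β]
          linarith)
        have hκ : κ (x - y) = 1 := κ.one_of_mem_closedBall (by
          have := norm_sub_le x y
          simp only [Metric.mem_closedBall, dist_zero_right, κ]
          linarith)
        simp [g, hβ, hκ]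
    have i1 : Integrable fun y => χ y • coulombField (x - y) :=
      (locallyIntegrable_coulombField_sub x).integrable_smul_left_of_hasCompactSupport
        χ.continuous χ.hasCompactSupport
    have e2 : ∀ y, U.indicator (fun _ => (1 : ℝ)) y • coulombField (x - y) =
        U.indicator (fun y => coulombField (x - y)) y := by
      intro y
      by_cases hy : y ∈ U <;> simp [hy]
    have i2 : Integrable fun y => U.indicator (fun _ => (1 : ℝ)) y • coulombField (x - y) := by
      simp_rw [e2]
      exact (integrableOn_coulombField_sub x hb).integrable_indicator hU.measurableSet
    rw [hA, hB]
    simp only [h, sub_smul]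
    rw [integral_sub i2 i1, add_sub_cancel]
    simp_rw [e2]
    rw [integral_indicator hU.measurableSet, fieldOf]
  exact (dA.add dB).congr_of_eventuallyEq heq

/-- The volume scales by R³ and the kernel by R⁻², leaving one factor R. -/
lemma fieldOf_restrict_smul {U : Set R3} {R : ℝ} (hR : 0 < R) (x : R3) :
    fieldOf (volume.restrict (R • U)) x = R • fieldOf (volume.restrict U) (R⁻¹ • x) := by
  have h := Measure.setIntegral_comp_smul_of_pos volume (fun y => coulombField (x - y)) U hR
  have hR' := hR.ne'
  have e : ∀ y : R3, coulombField (x - R • y) = (R ^ 2)⁻¹ • coulombField (R⁻¹ • x - y) := by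
    intro y
    rw [← coulombField_smul hR, smul_sub, smul_inv_smul₀ hR']
  simp_rw [e] at h
  rw [integral_smul, finrank_euclideanSpace_fin] at h
  unfold fieldOf
  rw [eq_inv_smul_iff₀ (by positivity), smul_smul] at h
  rw [← h]
  congr 1
  field_simp

/-- The hypothesis `hz` says b(0) = 0, so R b(x / R) is a difference quotient of b at 0. The locally
uniform bound is kept for dominated convergence. -/
lemma exists_linear_tendsto_fieldOf_restrict_smul {U : Set R3} (hU : IsOpen U)
    (hb : Bornology.IsBounded U) (h0 : 0 ∈ U) (hz : ∫ y in U, gradient coulomb y = 0) :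
    ∃ L : R3 →L[ℝ] R3,
      (∀ x, Tendsto (fun R : ℝ => fieldOf (volume.restrict (R • U)) x) atTop (𝓝 (L x))) ∧
      (∀ ρ, ∃ C, ∀ᶠ R : ℝ in atTop, ∀ x ∈ Metric.ball (0 : R3) ρ,
        ‖fieldOf (volume.restrict (R • U)) x‖ ≤ C) := by
  set b := fieldOf (volume.restrict U)
  have hb0 : b 0 = 0 := by
    simp only [gradient_coulomb] at hz
    simp only [b, fieldOf, zero_sub, coulombField_neg]
    exact hz
  obtain ⟨L, hL⟩ := differentiableAt_fieldOf_restrict hU hb h0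
  refine ⟨L, fun x => ?_, fun ρ => ?_⟩
  · have h1 := hL.lim_real x
    refine h1.congr' ?_
    filter_upwards [eventually_gt_atTop (0 : ℝ)] with R hR
    rw [fieldOf_restrict_smul hR]
    change R • (b (0 + R⁻¹ • x) - b 0) = R • b (R⁻¹ • x)
    rw [hb0, zero_add, sub_zero]
  · obtain ⟨c, hc⟩ := hL.isBigO_sub.bound
    obtain ⟨δ, hδ, hδc⟩ := Metric.eventually_nhds_iff.1 hc
    refine ⟨|c| * ρ, ?_⟩
    filter_upwards [eventually_gt_atTop (0 : ℝ), eventually_gt_atTop (ρ / δ)] with R hR hRρ x hx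
    have hx : ‖x‖ < ρ := by simpa using hx
    have hρR : ρ < R * δ := (div_lt_iff₀ hδ).1 hRρ
    have h1 : ‖R⁻¹ • x‖ = R⁻¹ * ‖x‖ := by rw [norm_smul, norm_inv, Real.norm_of_nonneg hR.le]
    have h2 := hδc (y := R⁻¹ • x) (by
      rw [dist_zero_right, h1, inv_mul_lt_iff₀ hR]; linarith)
    change ‖b (R⁻¹ • x) - b 0‖ ≤ c * ‖R⁻¹ • x - 0‖ at h2
    rw [hb0, sub_zero, sub_zero, h1] at h2
    rw [fieldOf_restrict_smul hR, norm_smul, Real.norm_of_nonneg hR.le]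
    calc R * ‖b (R⁻¹ • x)‖ ≤ R * (c * (R⁻¹ * ‖x‖)) := by gcongr
      _ = c * ‖x‖ := by field_simp
      _ ≤ |c| * ‖x‖ := by gcongr; exact le_abs_self c
      _ ≤ |c| * ρ := by gcongr

lemma ball_subset_smul {U : Set R3} {ε R : ℝ} (hε : Metric.ball (0 : R3) ε ⊆ U) (hR : 0 < R) :
    Metric.ball (0 : R3) (R * ε) ⊆ R • U := by
  intro x hx
  rw [Set.mem_smul_set_iff_inv_smul_mem₀ hR.ne']
  refine hε ?_
  rw [Metric.mem_ball, dist_zero_right, norm_smul, norm_inv, Real.norm_of_nonneg hR.le,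
    inv_mul_lt_iff₀ hR]
  simpa using hx

lemma smul_subset_ball {U : Set R3} {M R : ℝ} (hM : U ⊆ Metric.ball (0 : R3) M) (hR : 0 < R) :
    R • U ⊆ Metric.ball (0 : R3) (R * M) := by
  rintro _ ⟨x, hx, rfl⟩
  have : ‖x‖ < M := by simpa using hM hx
  simp only [Metric.mem_ball, dist_zero_right, norm_smul, Real.norm_of_nonneg hR.le]
  gcongr

lemma isFiniteMeasure_restrict_of_isBounded {W : Set R3} (hW : Bornology.IsBounded W) :
    IsFiniteMeasure (volume.restrict W) :=
  ⟨by simpa using hW.measure_lt_top⟩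

section limit
variable {U : Set R3} {L : R3 →L[ℝ] R3}

lemma IsTestForm.tendsto_integral_background {T : R3 → R3 →L[ℝ] ℝ} (hT : IsTestForm T)
    (hL : ∀ x, Tendsto (fun R : ℝ => fieldOf (volume.restrict (R • U)) x) atTop (𝓝 (L x)))
    (hC : ∀ ρ, ∃ C, ∀ᶠ R : ℝ in atTop, ∀ x ∈ Metric.ball (0 : R3) ρ,
      ‖fieldOf (volume.restrict (R • U)) x‖ ≤ C) :
    Tendsto (fun R : ℝ => ∫ x, T x (fieldOf (volume.restrict (R • U)) x)) atTop
      (𝓝 (∫ x, T x (L x))) := by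
  obtain ⟨-, ρ, -, hρ⟩ := hT.exists_bound
  obtain ⟨C, hC⟩ := hC ρ
  have iT : Integrable (fun x => ‖T x‖) :=
    hT.continuous.norm.integrable_of_hasCompactSupport hT.hasCompactSupport.norm
  refine tendsto_integral_filter_of_dominated_convergence (fun x => ‖T x‖ * C)
    (.of_forall fun R =>
      (hT.measurable_apply (measurable_fieldOf (volume.restrict (R • U)))).aestronglyMeasurable)
    ?_ (iT.mul_const C) (.of_forall fun x => ((T x).continuous.tendsto _).comp (hL x))
  filter_upwards [hC] with R hR
  refine .of_forall fun x => ?_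
  by_cases hx : x ∈ Metric.ball (0 : R3) ρ
  · exact ((T x).le_opNorm _).trans (mul_le_mul_of_nonneg_left (hR x hx) (norm_nonneg _))
  · simp [hρ x hx]

/-- The divergence of L is found without computing L: once `R • U` contains the support of φ, the
pairing no longer depends on R. -/
lemma integral_inner_linear_background (hU : IsOpen U)
    (hb : Bornology.IsBounded U) (h0 : 0 ∈ U)
    (hL : ∀ x, Tendsto (fun R : ℝ => fieldOf (volume.restrict (R • U)) x) atTop (𝓝 (L x)))
    (hC : ∀ ρ, ∃ C, ∀ᶠ R : ℝ in atTop, ∀ x ∈ Metric.ball (0 : R3) ρ,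
      ‖fieldOf (volume.restrict (R • U)) x‖ ≤ C) {φ : R3 → ℝ} (h : IsTest φ) :
    ∫ x, inner ℝ (L x) (gradient φ x) = -(4 * Real.pi * ∫ x, φ x) := by
  obtain ⟨ρ, hρ⟩ := h.exists_support_subset
  obtain ⟨ε, hε, hεU⟩ := Metric.isOpen_iff.1 hU 0 h0
  have hlim := h.isTestForm_divForm.tendsto_integral_background hL hC
  simp only [divForm_apply] at hlim
  have hconst : (fun R : ℝ => ∫ x, inner ℝ (fieldOf (volume.restrict (R • U)) x)
      (gradient φ x)) =ᶠ[atTop] fun _ => -(4 * Real.pi * ∫ x, φ x) := by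
    filter_upwards [eventually_gt_atTop (0 : ℝ), eventually_gt_atTop (ρ / ε)] with R hR hRρ
    have := isFiniteMeasure_restrict_of_isBounded (hb.smul₀ R)
    rw [integral_inner_fieldOf _ h]
    congr 2
    refine setIntegral_eq_integral_of_forall_compl_eq_zero fun x hx => (hρ x fun hx' => hx ?_).1
    exact ball_subset_smul hεU hR (Metric.ball_subset_ball ((div_lt_iff₀ hε).1 hRρ).le hx')
  exact tendsto_nhds_unique hlim (tendsto_const_nhds.congr' hconst.symm)

lemma integral_curl_linear_background (hb : Bornology.IsBounded U)
    (hL : ∀ x, Tendsto (fun R : ℝ => fieldOf (volume.restrict (R • U)) x) atTop (𝓝 (L x)))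
    (hC : ∀ ρ, ∃ C, ∀ᶠ R : ℝ in atTop, ∀ x ∈ Metric.ball (0 : R3) ρ,
      ‖fieldOf (volume.restrict (R • U)) x‖ ≤ C) {φ : R3 → ℝ} (h : IsTest φ) (i j : Fin 3) :
    ∫ x, (L x j * gradient φ x i - L x i * gradient φ x j) = 0 := by
  have hlim := (h.isTestForm_curlForm i j).tendsto_integral_background hL hC
  simp only [curlForm_apply] at hlim
  refine tendsto_nhds_unique hlim (tendsto_const_nhds.congr fun R => ?_)
  have := isFiniteMeasure_restrict_of_isBounded (hb.smul₀ R)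
  exact (integral_curl_fieldOf _ h i j).symm

end limit

end

/-! ### From clouds to centered fields, and passage to the limit. -/

section

variable {I : Finset ℝ} {μ : PMF I} {P : Measure (ChargedConfig I)}

lemma integral_ptMeasure {E : Type*} [NormedAddCommGroup E] [NormedSpace ℝ E] [CompleteSpace E]
    (q : I) {W : Set R3} (hW : Bornology.IsBounded W) (ω : ChargedConfig I) (g : R3 → E) :
    ∫ y, g y ∂(ptMeasure q W ω) = ∑ y ∈ (ω.finite_setOf_mem q hW).toFinset, g y := by
  have h : ptMeasure q W ω = ∑ y ∈ (ω.finite_setOf_mem q hW).toFinset, Measure.dirac y := by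
    classical
    ext A hA
    have hfin := (ω.finite_setOf_mem q hW).subset
      (Set.inter_subset_right (s := A) (t := {x | x ∈ W ∧ (x, q) ∈ ω.carrier}))
    rw [ptMeasure, Measure.restrict_apply hA, Measure.count_apply_finite _ hfin,
      Measure.finsetSum_apply]
    simp_rw [Measure.dirac_apply' _ hA, Set.indicator_apply, Pi.one_apply]
    rw [Finset.sum_boole]
    congr 2
    ext x
    simp [and_comm]
  rw [h, integral_finsetSum_measure fun y _ => integrable_dirac (by simp)]
  simp

lemma finsum_mem_eq_sum_integral {E : Type*} [NormedAddCommGroup E] [NormedSpace ℝ E]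
    [CompleteSpace E] {W : Set R3} (hW : Bornology.IsBounded W) (ω : ChargedConfig I)
    (g : R3 → E) :
    ∑ᶠ p ∈ {p ∈ ω.carrier | p.1 ∈ W}, (p.2 : ℝ) • g p.1 =
      ∑ q : I, (q : ℝ) • ∫ y, g y ∂(ptMeasure q W ω) := by
  classical
  have hfin : {p ∈ ω.carrier | p.1 ∈ W}.Finite :=
    (ω.locallyFinite _ hW.isCompact_closure).subset fun p hp => ⟨hp.1, subset_closure hp.2⟩
  rw [finsum_mem_eq_finite_toFinset_sum _ hfin, ← Finset.sum_fiberwise _ Prod.snd]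
  refine Finset.sum_congr rfl fun q _ => ?_
  rw [integral_ptMeasure q hW, Finset.smul_sum]
  refine Finset.sum_nbij' Prod.fst (fun y => (y, q)) ?_ ?_ ?_ ?_ ?_
  · rintro ⟨y, q'⟩ hp
    simp only [Finset.mem_filter, Set.Finite.mem_toFinset, Set.mem_ofPred_eq] at hp ⊢
    obtain ⟨⟨h1, h2⟩, rfl⟩ := hp
    exact ⟨h2, h1⟩
  · intro y hy
    simp only [Finset.mem_filter, Set.Finite.mem_toFinset, Set.mem_ofPred_eq] at hy ⊢
    exact ⟨⟨hy.2, hy.1⟩, trivial⟩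
  · rintro ⟨y, q'⟩ hp
    simp only [Finset.mem_filter] at hp
    rw [← hp.2]
  · intro y _; rfl
  · rintro ⟨y, q'⟩ hp
    simp only [Finset.mem_filter] at hp
    rw [← hp.2]

lemma chargeDist_eq_sum_integral {W : Set R3} (hW : Bornology.IsBounded W) (ω : ChargedConfig I)
    {φ : R3 → ℝ} (hφ : ∀ x, x ∉ W → φ x = 0) :
    chargeDist ω φ = ∑ q : I, (q : ℝ) * ∫ y, φ y ∂(ptMeasure q W ω) := by
  rw [chargeDist]
  simp_rw [← smul_eq_mul]
  rw [← finsum_mem_eq_sum_integral hW]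
  refine finsum_mem_inter_support_eq' _ _ _ fun p hp => ⟨fun h => ⟨h, ?_⟩, fun h => h.1⟩
  by_contra hpW
  exact hp (by simp [hφ _ hpW])

lemma meanCharge_smul_eq {E : Type*} [AddCommGroup E] [Module ℝ E] (v : E) :
    meanCharge μ • v = ∑ q : I, (q : ℝ) • (μ q).toReal • v := by
  rw [meanCharge, Finset.sum_smul]
  simp_rw [smul_smul]

lemma cloudField_eq {U : Set R3} (hb : Bornology.IsBounded U) (R : ℝ) (x : R3)
    (ω : ChargedConfig I) :
    cloudField coulomb U R x ω = centeredField μ (R • U) x ω +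
      meanCharge μ • fieldOf (volume.restrict (R • U)) x := by
  rw [cloudField, finsum_mem_eq_sum_integral (hb.smul₀ R) ω (fun y => gradient coulomb (x - y)),
    meanCharge_smul_eq, centeredField, ← Finset.sum_add_distrib, ← Finset.sum_neg_distrib]
  refine Finset.sum_congr rfl fun q _ => ?_
  simp_rw [gradient_coulomb]
  rw [integral_neg, smul_neg, neg_neg, smul_sub, sub_add_cancel, fieldOf]

lemma coe_eq_one (q : ({1} : Finset ℝ)) : (q : ℝ) = 1 := Finset.mem_singleton.1 q.2

lemma meanCharge_eq_one (μ : PMF ({1} : Finset ℝ)) : meanCharge μ = 1 := by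
  simp_rw [meanCharge, coe_eq_one, one_mul]
  rw [← ENNReal.toReal_sum fun q _ => μ.apply_ne_top q, ← tsum_fintype (L := .unconditional _),
    μ.tsum_coe]
  simp

lemma cloudFieldBackground_eq (μ : PMF ({1} : Finset ℝ)) {U : Set R3}
    (hb : Bornology.IsBounded U) (R : ℝ) (x : R3) (ω : ChargedConfig {(1 : ℝ)}) :
    cloudFieldBackground coulomb U R x ω = centeredField μ (R • U) x ω := by
  have h := cloudField_eq (μ := μ) hb R x ω
  rw [meanCharge_eq_one, one_smul, cloudField] at h
  simp_rw [coe_eq_one, one_smul] at h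
  rw [cloudFieldBackground, neg_sub, sub_eq_add_neg, h]
  simp_rw [gradient_coulomb]
  rw [integral_neg, fieldOf]
  abel

lemma pointDist_eq_chargeDist (ω : ChargedConfig {(1 : ℝ)}) (φ : R3 → ℝ) :
    pointDist ω φ = chargeDist ω φ := by
  simp_rw [pointDist, chargeDist, coe_eq_one, one_mul]

section dyadic
variable (μ) (ω : ChargedConfig I)

lemma integrableOn_dyadicField (n : ℕ) (ρ : ℝ) :
    IntegrableOn (fun x => dyadicField μ n x ω) (Metric.ball 0 ρ) := by
  have := isFiniteMeasure_restrict_of_isBounded (Metric.isBounded_ball (x := (0 : R3)) (r := 2 ^ n))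
  unfold dyadicField centeredField
  exact integrable_finsetSum _ fun q _ =>
    ((integrableOn_fieldOf (ptMeasure q (Metric.ball 0 (2 ^ n)) ω) ρ).sub
      ((integrableOn_fieldOf _ ρ).smul (μ q).toReal)).smul (q : ℝ)

lemma IsTestForm.integral_apply_dyadicField {T : R3 → R3 →L[ℝ] ℝ} (hT : IsTestForm T) (n : ℕ) :
    ∫ x, T x (dyadicField μ n x ω) = ∑ q : I, (q : ℝ) *
      ((∫ x, T x (fieldOf (ptMeasure q (Metric.ball 0 (2 ^ n)) ω) x)) -
        (μ q).toReal * ∫ x, T x (fieldOf (volume.restrict (Metric.ball 0 (2 ^ n))) x)) := by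
  have := isFiniteMeasure_restrict_of_isBounded (Metric.isBounded_ball (x := (0 : R3)) (r := 2 ^ n))
  have i1 : ∀ q : I, Integrable
      (fun x => T x (fieldOf (ptMeasure q (Metric.ball 0 (2 ^ n)) ω) x)) := fun q =>
    hT.integrable_apply fun ρ => integrableOn_fieldOf _ ρ
  have i2 : Integrable (fun x => T x (fieldOf (volume.restrict (Metric.ball 0 (2 ^ n))) x)) :=
    hT.integrable_apply fun ρ => integrableOn_fieldOf _ ρ
  have i3 : ∀ q : I, Integrable (fun x =>
      T x (fieldOf (ptMeasure q (Metric.ball 0 (2 ^ n)) ω) x) -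
        (μ q).toReal * T x (fieldOf (volume.restrict (Metric.ball 0 (2 ^ n))) x)) := fun q =>
    (i1 q).sub (i2.const_mul _)
  simp only [dyadicField, centeredField, map_sum, map_smul, map_sub, smul_eq_mul]
  rw [integral_finsetSum _ fun q _ => (i3 q).const_mul _]
  refine Finset.sum_congr rfl fun q _ => ?_
  rw [integral_const_mul, integral_sub (i1 q) (i2.const_mul _), integral_const_mul]

/-- A ball containing the support of φ sees all charges and all background that φ can see, so the
value is already independent of n. -/
lemma integral_inner_dyadicField {φ : R3 → ℝ} (h : IsTest φ) {n : ℕ}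
    (hn : ∀ x, x ∉ Metric.ball (0 : R3) (2 ^ n) → φ x = 0) :
    ∫ x, inner ℝ (dyadicField μ n x ω) (gradient φ x) =
      -(4 * Real.pi * (chargeDist ω φ - meanCharge μ * ∫ x, φ x)) := by
  have := isFiniteMeasure_restrict_of_isBounded (Metric.isBounded_ball (x := (0 : R3)) (r := 2 ^ n))
  simp_rw [← divForm_apply]
  rw [h.isTestForm_divForm.integral_apply_dyadicField]
  simp_rw [divForm_apply, integral_inner_fieldOf _ h]
  rw [setIntegral_eq_integral_of_forall_compl_eq_zero hn,
    chargeDist_eq_sum_integral Metric.isBounded_ball ω hn, meanCharge, Finset.sum_mul,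
    ← Finset.sum_sub_distrib, Finset.mul_sum, ← Finset.sum_neg_distrib]
  exact Finset.sum_congr rfl fun q _ => by ring

lemma integral_curl_dyadicField {φ : R3 → ℝ} (h : IsTest φ) (n : ℕ) (i j : Fin 3) :
    ∫ x, (dyadicField μ n x ω j * gradient φ x i - dyadicField μ n x ω i * gradient φ x j) = 0 := by
  have := isFiniteMeasure_restrict_of_isBounded (Metric.isBounded_ball (x := (0 : R3)) (r := 2 ^ n))
  simp_rw [← curlForm_apply]
  rw [(h.isTestForm_curlForm i j).integral_apply_dyadicField]
  simp_rw [curlForm_apply, integral_curl_fieldOf _ h]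
  simp

end dyadic

lemma integrableOn_of_tendsto_setLIntegral {ψ : R3 → R3} (hψ : Measurable ψ) {g : ℕ → R3 → R3}
    {s : Set R3} (hg : ∀ n, IntegrableOn (g n) s)
    (h : Tendsto (fun n => ∫⁻ x in s, ‖ψ x - g n x‖ₑ) atTop (𝓝 0)) : IntegrableOn ψ s := by
  obtain ⟨n, hn⟩ := (h.eventually_lt_const ENNReal.zero_lt_top).exists
  have h1 : IntegrableOn (fun x => ψ x - g n x) s :=
    ⟨hψ.aestronglyMeasurable.sub (hg n).aestronglyMeasurable, hn⟩
  exact (h1.add (hg n)).congr (.of_forall fun x => by simp)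

lemma IsTestForm.tendsto_integral_apply {T : R3 → R3 →L[ℝ] ℝ} (hT : IsTestForm T)
    {ψ : R3 → R3} {g : ℕ → R3 → R3} (hψ : ∀ ρ : ℕ, IntegrableOn ψ (Metric.ball 0 ρ))
    (hg : ∀ n, ∀ ρ : ℕ, IntegrableOn (g n) (Metric.ball 0 ρ))
    (h : ∀ ρ : ℕ, Tendsto (fun n => ∫⁻ x in Metric.ball (0 : R3) ρ, ‖ψ x - g n x‖ₑ) atTop (𝓝 0)) :
    Tendsto (fun n => ∫ x, T x (g n x)) atTop (𝓝 (∫ x, T x (ψ x))) := by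
  obtain ⟨⟨M, hM⟩, ρ, -, hρ⟩ := hT.exists_bound
  simp_rw [fun n => IsTestForm.integral_apply_eq_setIntegral hρ (g n),
    IsTestForm.integral_apply_eq_setIntegral hρ ψ]
  refine tendsto_integral_of_L1 _ (hT.integrableOn_apply (hψ ρ)).aestronglyMeasurable
    (.of_forall fun n => hT.integrableOn_apply (hg n ρ)) ?_
  have h2 := ENNReal.Tendsto.const_mul (a := ENNReal.ofReal M) (h ρ) (Or.inr ENNReal.ofReal_ne_top)
  rw [mul_zero] at h2
  refine tendsto_of_tendsto_of_tendsto_of_le_of_le tendsto_const_nhds h2 (fun n => zero_le)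
    fun n => ?_
  simp only
  rw [← lintegral_const_mul' _ _ ENNReal.ofReal_ne_top]
  refine lintegral_mono fun x => ?_
  simp only
  rw [← map_sub, enorm_sub_rev, ← ofReal_norm (g n x - ψ x), ← ofReal_norm (T x _),
    ← ENNReal.ofReal_mul ((norm_nonneg _).trans (hM 0))]
  refine ENNReal.ofReal_le_ofReal (((T x).le_opNorm _).trans ?_)
  exact mul_le_mul_of_nonneg_right (hM x) (norm_nonneg _)

section limit
variable [IsProbabilityMeasure P]

/-- With 2ⁿ ≤ R ε < 2ⁿ⁺¹, the set `R • U` contains the ball of radius 2ⁿ and lies in that of radius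
c 2ⁿ, c = 2M/ε, so it is compared with the n-th dyadic field. -/
lemma IsPoissonLaw.tendsto_lintegral_centeredField_sub (hP : IsPoissonLaw μ P) {U : Set R3}
    (hU : IsOpen U) (hb : Bornology.IsBounded U) (h0 : 0 ∈ U) (x : R3) :
    Tendsto (fun R : ℝ => ∫⁻ ω, ‖centeredField μ (R • U) x ω - limitField μ x ω‖ₑ ∂P)
      atTop (𝓝 0) := by
  obtain ⟨ε, hε, hεU⟩ := Metric.isOpen_iff.1 hU 0 h0
  obtain ⟨M, hM⟩ := hb.subset_ball 0
  have hM0 : 0 < M := by simpa using hM h0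
  set c : ℝ := 2 * M / ε
  set A : ℝ := annulusConst I * √(c ^ 3)
  have hgeo : Tendsto (fun n : ℕ => ENNReal.ofReal (A * (√8 / 4) ^ n)) atTop (𝓝 0) := by
    have h1 := (tendsto_pow_atTop_nhds_zero_of_lt_one (r := √8 / 4) (by positivity)
      sqrt_eight_div_four_lt_one).const_mul A
    rw [mul_zero] at h1
    simpa using ENNReal.tendsto_ofReal h1
  have hsum := hgeo.add (hP.tendsto_lintegral_limitField_sub x)
  rw [add_zero] at hsum
  obtain ⟨k, hk⟩ := exists_le_two_pow_add_div_two ‖x‖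
  rw [ENNReal.tendsto_nhds_zero] at hsum ⊢
  intro δ hδ
  obtain ⟨N, hN⟩ := eventually_atTop.1 (hsum δ hδ)
  filter_upwards [eventually_gt_atTop (0 : ℝ), eventually_ge_atTop (2 ^ (N + k) / ε)] with R hR hRN
  have hRε : 2 ^ (N + k) ≤ R * ε := (div_le_iff₀ hε).1 hRN
  obtain ⟨n, hn1, hn2⟩ := exists_nat_pow_near (le_trans (one_le_pow₀ one_le_two) hRε)
    (one_lt_two (α := ℝ))
  have hNn : N + k ≤ n := by
    have : (2 : ℝ) ^ (N + k) < 2 ^ (n + 1) := hRε.trans_lt hn2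
    have := (pow_lt_pow_iff_right₀ (one_lt_two (α := ℝ))).1 this
    omega
  have hm1 : Measurable (centeredField μ (R • U) x) :=
    (measurable_centeredField μ (hU.smul₀ hR.ne').measurableSet (hb.smul₀ R)).of_uncurry_left
  have hm2 : Measurable (dyadicField μ n x) := (measurable_dyadicField μ n).of_uncurry_left
  have hxn : ‖x‖ ≤ 2 ^ n / 2 := by
    have := hk (n - k)
    rwa [Nat.add_sub_cancel' (by omega)] at this
  have hle := hP.lintegral_enorm_sub_dyadicField_le (W := R • U) (M := c) (n := n)
    (hU.smul₀ hR.ne').measurableSet (by positivity)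
    ((Metric.ball_subset_ball hn1).trans (ball_subset_smul hεU hR))
    ((smul_subset_ball hM hR).trans (Metric.ball_subset_ball (by
      have : R * M = (R * ε) * (M / ε) := by field_simp
      rw [this]
      calc R * ε * (M / ε) ≤ 2 ^ (n + 1) * (M / ε) := by gcongr
        _ = c * 2 ^ n := by simp only [c]; ring))) hxn
  calc ∫⁻ ω, ‖centeredField μ (R • U) x ω - limitField μ x ω‖ₑ ∂P
      ≤ ∫⁻ ω, (‖centeredField μ (R • U) x ω - dyadicField μ n x ω‖ₑ +
          ‖limitField μ x ω - dyadicField μ n x ω‖ₑ) ∂P := by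
        refine lintegral_mono fun ω => ?_
        rw [← sub_sub_sub_cancel_right _ _ (dyadicField μ n x ω)]
        exact enorm_sub_le
    _ = ∫⁻ ω, ‖centeredField μ (R • U) x ω - dyadicField μ n x ω‖ₑ ∂P +
          ∫⁻ ω, ‖limitField μ x ω - dyadicField μ n x ω‖ₑ ∂P :=
        lintegral_add_left (hm1.sub hm2).enorm _
    _ ≤ _ := add_le_add_left hle _
    _ ≤ δ := hN n (by omega)

/-- The core statement: fields that differ from the centered field of the cloud `R U` by a
deterministic field converging to `ℓ`. -/
theorem IsPoissonLaw.limitField_properties (hP : IsPoissonLaw μ P) {U : Set R3}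
    (hU : IsOpen U) (hb : Bornology.IsBounded U) (h0 : 0 ∈ U)
    {FR : ℝ → R3 → ChargedConfig I → R3} {c : ℝ → R3 → R3} {ℓ : R3 → R3}
    (hFR : ∀ R x ω, FR R x ω = centeredField μ (R • U) x ω + c R x)
    (hc : ∀ x, Tendsto (fun R => c R x) atTop (𝓝 (ℓ x))) (hℓ : Continuous ℓ) {D : ℝ}
    (hdiv : ∀ φ, IsTest φ → ∫ x, inner ℝ (ℓ x) (gradient φ x) = -(4 * Real.pi * (D * ∫ x, φ x)))
    (hcurl : ∀ φ, IsTest φ → ∀ i j : Fin 3,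
      ∫ x, (ℓ x j * gradient φ x i - ℓ x i * gradient φ x j) = 0) :
    (∃ F, IsLimitField P FR F) ∧ ∀ F, IsLimitField P FR F → ∀ᵐ ω ∂P,
      LocallyIntegrable (fun x => F x ω) volume ∧
      WeakDivEq (fun x => F x ω)
        (fun φ => 4 * Real.pi * (chargeDist ω φ - (meanCharge μ - D) * ∫ x, φ x)) ∧
      WeakCurlZero (fun x => F x ω) := by
  set F₀ : R3 → ChargedConfig I → R3 := fun x ω => limitField μ x ω + ℓ x
  have hF₀ : Measurable (Function.uncurry F₀) :=
    (measurable_limitField μ).add (hℓ.measurable.comp measurable_fst)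
  -- Measurability is needed for every real R, including R = 0, where the dilate collapses to a
  -- point.
  have hset : ∀ R : ℝ, MeasurableSet (R • U) := by
    intro R
    by_cases hR : R = 0
    · rw [hR, Set.zero_smul_set ⟨0, h0⟩]
      exact measurableSet_singleton 0
    · exact (hU.smul₀ hR).measurableSet
  have hm : ∀ R x, Measurable (FR R x) := by
    intro R x
    have h1 : Measurable (centeredField μ (R • U) x) :=
      (measurable_centeredField μ (hset R) (hb.smul₀ R)).of_uncurry_left
    have h2 : FR R x = fun ω => centeredField μ (R • U) x ω + c R x := funext (hFR R x)
    rw [h2]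
    exact h1.add_const _
  have hprob : ∀ x, TendstoInMeasure P (fun R => FR R x) atTop (F₀ x) := by
    intro x
    refine tendstoInMeasure_of_tendsto_eLpNorm one_ne_zero
      (fun R => (hm R x).aestronglyMeasurable) hF₀.of_uncurry_left.aestronglyMeasurable ?_
    simp_rw [eLpNorm_one_eq_lintegral_enorm]
    have hcx : Tendsto (fun R => ‖c R x - ℓ x‖ₑ) atTop (𝓝 0) := by
      have := ((hc x).sub_const (ℓ x)).enorm
      simpa using this
    have hsum := (hP.tendsto_lintegral_centeredField_sub hU hb h0 x).add hcx
    rw [add_zero] at hsum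
    refine tendsto_of_tendsto_of_tendsto_of_le_of_le tendsto_const_nhds hsum (fun R => zero_le)
      fun R => ?_
    calc ∫⁻ ω, ‖(FR R x - F₀ x) ω‖ₑ ∂P
        ≤ ∫⁻ ω, (‖centeredField μ (R • U) x ω - limitField μ x ω‖ₑ + ‖c R x - ℓ x‖ₑ) ∂P := by
          refine lintegral_mono fun ω => ?_
          have : (FR R x - F₀ x) ω = (centeredField μ (R • U) x ω - limitField μ x ω) +
              (c R x - ℓ x) := by
            simp only [Pi.sub_apply, hFR, F₀]; abel
          rw [this]
          exact enorm_add_le _ _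
      _ = _ := by
          rw [lintegral_add_right _ measurable_const]; simp
  refine ⟨⟨F₀, hF₀, fun x => (hprob x).tendstoInDistribution_of_aemeasurable
    (fun R => (hm R x).aemeasurable) hF₀.of_uncurry_left.aemeasurable, hprob⟩, fun F hF => ?_⟩
  -- Limits in probability agree off a null set depending on x; joint measurability and Fubini
  -- exchange the quantifiers.
  have hae : ∀ᵐ ω ∂P, ∀ᵐ x : R3, F x ω = F₀ x ω := by
    refine (Measure.ae_ae_comm (p := fun x ω => F x ω = F₀ x ω)
      (measurableSet_eq_fun hF.measurable hF₀)).1 (.of_forall fun x => ?_)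
    exact tendstoInMeasure_ae_unique (hF.tendsto_prob x) (hprob x)
  have hconv : ∀ᵐ ω ∂P, ∀ ρ : ℕ, Tendsto (fun n => ∫⁻ x in Metric.ball (0 : R3) ρ,
      ‖limitField μ x ω - dyadicField μ n x ω‖ₑ) atTop (𝓝 0) :=
    ae_all_iff.2 fun ρ => hP.ae_tendsto_setLIntegral_limitField_sub ρ
  filter_upwards [hae, hconv] with ω hω hρ
  have hgint : ∀ n, ∀ ρ : ℕ, IntegrableOn (fun x => dyadicField μ n x ω) (Metric.ball 0 ρ) :=
    fun n ρ => integrableOn_dyadicField μ ω n ρ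
  have hψint : ∀ ρ : ℕ, IntegrableOn (fun x => limitField μ x ω) (Metric.ball 0 ρ) := fun ρ =>
    integrableOn_of_tendsto_setLIntegral (measurable_limitField μ).of_uncurry_right
      (fun n => hgint n ρ) (hρ ρ)
  have hℓint : ∀ ρ : ℕ, IntegrableOn ℓ (Metric.ball 0 ρ) := fun ρ =>
    (hℓ.continuousOn.integrableOn_compact (isCompact_closedBall 0 (ρ : ℝ))).mono_set
      Metric.ball_subset_closedBall
  have hsplit : ∀ T, IsTestForm T →
      ∫ x, T x (F x ω) = (∫ x, T x (limitField μ x ω)) + ∫ x, T x (ℓ x) := by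
    intro T hT
    rw [← integral_add (hT.integrable_apply hψint) (hT.integrable_apply hℓint)]
    refine integral_congr_ae ?_
    filter_upwards [hω] with x hx
    rw [hx, map_add]
  refine ⟨locallyIntegrable_of_forall_ball fun ρ => ?_, fun φ hφ => ?_, fun φ hφ i j => ?_⟩
  · exact ((hψint ρ).add (hℓint ρ)).congr (ae_restrict_of_ae (hω.mono fun x hx => hx.symm))
  · obtain ⟨ρ, hsupp⟩ := hφ.exists_support_subset
    have hlim := hφ.isTestForm_divForm.tendsto_integral_apply hψint hgint hρ
    have hval : ∫ x, divForm φ x (limitField μ x ω) =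
        -(4 * Real.pi * (chargeDist ω φ - meanCharge μ * ∫ x, φ x)) := by
      refine tendsto_nhds_unique hlim (tendsto_const_nhds.congr' ?_)
      have hpow : ∀ᶠ n : ℕ in atTop, (ρ : ℝ) ≤ 2 ^ n :=
        (tendsto_pow_atTop_atTop_of_one_lt (one_lt_two (α := ℝ))).eventually_ge_atTop _
      filter_upwards [hpow] with n hn
      simp_rw [divForm_apply]
      exact (integral_inner_dyadicField μ ω hφ fun x hx =>
        (hsupp x fun hx' => hx (Metric.ball_subset_ball hn hx')).1).symm
    have h1 := hsplit _ hφ.isTestForm_divForm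
    rw [hval] at h1
    simp_rw [divForm_apply] at h1
    rw [h1, hdiv φ hφ]
    ring
  · have hlim := (hφ.isTestForm_curlForm i j).tendsto_integral_apply hψint hgint hρ
    have hval : ∫ x, curlForm φ i j x (limitField μ x ω) = 0 := by
      refine tendsto_nhds_unique hlim (tendsto_const_nhds.congr fun n => ?_)
      simp_rw [curlForm_apply]
      exact (integral_curl_dyadicField μ ω hφ n i j).symm
    have h1 := hsplit _ (hφ.isTestForm_curlForm i j)
    rw [hval] at h1
    simp_rw [curlForm_apply] at h1
    rw [h1, hcurl φ hφ i j, add_zero]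

end limit

/-- The background term of the cloud field vanishes for a neutral law, and converges to a linear
field of divergence `4π` times the mean charge if the Coulomb integral of `U` is zero. -/
lemma exists_tendsto_meanCharge_smul_background {U : Set R3} (hU : IsOpen U)
    (hb : Bornology.IsBounded U) (h0 : 0 ∈ U)
    (h : meanCharge μ = 0 ∨ ∫ y in U, gradient coulomb y = 0) :
    ∃ ℓ : R3 → R3, Continuous ℓ ∧
      (∀ x, Tendsto (fun R : ℝ => meanCharge μ • fieldOf (volume.restrict (R • U)) x) atTop
        (𝓝 (ℓ x))) ∧
      (∀ φ, IsTest φ → ∫ x, inner ℝ (ℓ x) (gradient φ x) =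
        -(4 * Real.pi * (meanCharge μ * ∫ x, φ x))) ∧
      ∀ φ, IsTest φ → ∀ i j : Fin 3,
        ∫ x, (ℓ x j * gradient φ x i - ℓ x i * gradient φ x j) = 0 := by
  rcases h with h | h
  · exact ⟨0, continuous_const, by simp [h], by simp [h], by simp⟩
  · obtain ⟨L, hL, hC⟩ := exists_linear_tendsto_fieldOf_restrict_smul hU hb h0 h
    refine ⟨fun x => meanCharge μ • L x, by fun_prop,
      fun x => (hL x).const_smul _, fun φ hφ => ?_, fun φ hφ i j => ?_⟩
    · simp_rw [real_inner_smul_left]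
      rw [integral_const_mul, integral_inner_linear_background hU hb h0 hL hC hφ]
      ring
    · simp_rw [PiLp.smul_apply, smul_eq_mul, mul_assoc, ← mul_sub]
      rw [integral_const_mul, integral_curl_linear_background hb hL hC hφ, mul_zero]

end

end Holtsmark

end

theorem mainTheorem3 :
    -- (i) the neutral case and the case of a domain with vanishing Coulomb integral
    (∀ (I : Finset ℝ) (μ : PMF I) (P : Measure (Holtsmark.ChargedConfig I))
        [IsProbabilityMeasure P], Holtsmark.IsPoissonLaw μ P →
      ∀ U : Set Holtsmark.R3, IsOpen U → Bornology.IsBounded U → 0 ∈ U →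
        Holtsmark.HasC1Boundary U →
      (Holtsmark.meanCharge μ = 0 ∨ ∫ y in U, gradient Holtsmark.coulomb y = 0) →
      (∃ F : Holtsmark.R3 → Holtsmark.ChargedConfig I → Holtsmark.R3,
        Holtsmark.IsLimitField P (Holtsmark.cloudField Holtsmark.coulomb U) F) ∧
      ∀ F : Holtsmark.R3 → Holtsmark.ChargedConfig I → Holtsmark.R3,
        Holtsmark.IsLimitField P (Holtsmark.cloudField Holtsmark.coulomb U) F →
        ∀ᵐ ω ∂P,
          LocallyIntegrable (fun x => F x ω) volume ∧
          Holtsmark.WeakDivEq (fun x => F x ω)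
            (fun φ => 4 * Real.pi * Holtsmark.chargeDist ω φ) ∧
          Holtsmark.WeakCurlZero (fun x => F x ω)) ∧
    -- (ii) unit charges with a uniform background
    (∀ (μ : PMF ({1} : Finset ℝ)) (P : Measure (Holtsmark.ChargedConfig {1}))
        [IsProbabilityMeasure P], Holtsmark.IsPoissonLaw μ P →
      ∀ U : Set Holtsmark.R3, IsOpen U → Bornology.IsBounded U → 0 ∈ U →
        Holtsmark.HasC1Boundary U →
      (∃ F : Holtsmark.R3 → Holtsmark.ChargedConfig {1} → Holtsmark.R3,
        Holtsmark.IsLimitField P (Holtsmark.cloudFieldBackground Holtsmark.coulomb U) F) ∧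
      ∀ F : Holtsmark.R3 → Holtsmark.ChargedConfig {1} → Holtsmark.R3,
        Holtsmark.IsLimitField P (Holtsmark.cloudFieldBackground Holtsmark.coulomb U) F →
        ∀ᵐ ω ∂P,
          LocallyIntegrable (fun x => F x ω) volume ∧
          Holtsmark.WeakDivEq (fun x => F x ω)
            (fun φ => 4 * Real.pi * (Holtsmark.pointDist ω φ - ∫ x, φ x)) ∧
          Holtsmark.WeakCurlZero (fun x => F x ω)) := by
  refine ⟨fun I μ P _ hP U hU hb h0 _ h => ?_, fun μ P _ hP U hU hb h0 _ => ?_⟩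
  · obtain ⟨ℓ, hℓ, hlim, hdiv, hcurl⟩ :=
      Holtsmark.exists_tendsto_meanCharge_smul_background hU hb h0 h
    -- Here D is the mean charge, so the uniform term in the divergence cancels.
    have := hP.limitField_properties hU hb h0
      (FR := Holtsmark.cloudField Holtsmark.coulomb U)
      (fun R x ω => Holtsmark.cloudField_eq hb R x ω) hlim hℓ hdiv hcurl
    simpa only [sub_self, zero_mul, sub_zero] using this
  -- With D = 0 nothing offsets the mean charge 1, which remains as the term -∫ φ.
  · have := hP.limitField_properties hU hb h0
      (FR := Holtsmark.cloudFieldBackground Holtsmark.coulomb U) (c := 0) (ℓ := 0) (D := 0)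
      (fun R x ω => by
        rw [Holtsmark.cloudFieldBackground_eq μ hb, Pi.zero_apply, Pi.zero_apply, add_zero])
      (fun _ => tendsto_const_nhds) continuous_const (by simp) (by simp)
    simpa only [Holtsmark.meanCharge_eq_one, sub_zero, one_mul,
      ← Holtsmark.pointDist_eq_chargeDist] using this
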